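/- All functions and distributions below live on $\mathbb{R}^3$. Write $\|u\|_{H^\sigma}=\|\langle\nabla\rangle^\sigma u\|_{L^2}$ and $\|u\|_{\dot H^\sigma}=\||\nabla|^\sigma u\|_{L^2}$, where $\dot H^\sigma$ consists of the tempered distributions whose Fourier transform is a function and whose $\dot H^\sigma$ norm is finite. Let $1-\mathbf{P}=\Delta^{-1}\nabla(\nabla\cdot\,)$, i.e. the matrix Fourier multiplier $\xi_j\xi_k/|\xi|^2$. Products of an $H^s$ function with an $H^{s-1}$ distribution are understood as the continuous extension of the pointwise product; their Fourier transform is the absolutely convergent convolution of the Fourier transforms (suitably normalised). **Proposition 3.1 ($A_0$ estimates).** Let $3/4<s\le 1$. There is a constant $C$, depending only on $s$, such that the following holds. Let $\phi\in H^s$ be complex-valued, let $\underline{A}=(A_1,A_2,A_3)\in H^s$ be real-valued, and let $\phi_t\in H^{s-1}$ be complex-valued (here $\phi_t$ is only a label; no compatibility condition is assumed). Then there is exactly one pair of real-valued functions $A_0\in\dot H^1$, $A_{0,t}\in L^2$ such that, in the sense of tempered distributions, $$(-\Delta+|\phi|^2)A_0=\operatorname{Im}(\phi\overline{\phi_t}),\qquad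 \nabla A_{0,t}=-(1-\mathbf{P})\operatorname{Im}(\phi\overline{\nabla\phi})+(1-\mathbf{P})(\underline{A}|\phi|^2).\qquad(*)$$ Moreover $\phi\overline{\phi_t}\in\dot H^{-1}$ and $$\|A_0\|_{\dot H^1}\le C\,\|\phi\overline{\phi_t}\|_{\dot H^{-1}},$$ $$\max\bigl(\|A_0\|_{\dot H^1},\|A_{0,t}\|_{L^2}\bigr)\le C\sum_{j=2}^{3}\bigl(\|\phi\|_{H^s}+\|\underline{A}\|_{H^s}+\|\phi_t\|_{H^{s-1}}\bigr)^j.$$ Furthermore, if also $\phi',\underline{A}'\in H^s$ and $\phi'_t\in H^{s-1}$ (with $\underline{A}'$ real-valued), and $A_0',A_{0,t}'$ is the corresponding solution of $(*)$ with data $\phi',\underline{A}',\phi'_t$, then $$\max\bigl(\|A_0-A_0'\|_{\dot H^1},\|A_{0,t}-A_{0,t}'\|_{L^2}\bigr)\le C\,M^5\bigl(\|\phi-\phi'\|_{H^s}+\|\underline{A}-\underline{A}'\|_{H^s}+\|\phi_t-\phi_t'\|_{H^{s-1}}\bigr),$$ where $$M=1+\|\phi\|_{H^s}+\|\underline{A}\|_{H^s}+\|\phi_t\|_{H^{s-1}}+\|\phi'\|_{H^s}+\|\underline{A}'\|_{H^s}+\|\phi'_t\|_{H^{s-1}}.$$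 -/

import Mathlib

open MeasureTheory TemperedDistribution FourierTransform
open scoped SchwartzMap ENNReal NNReal LineDeriv Laplacian

noncomputable section

namespace MKG

/-- Physical space `ℝ³`; the same space serves as frequency space. -/
abbrev E3 : Type := EuclideanSpace ℝ (Fin 3)

/-- Complex-valued tempered distributions on `ℝ³`. -/
abbrev TD : Type := 𝓢'(E3, ℂ)

/-- `L²(ℝ³; ℂ)`. -/
abbrev L2C : Type := Lp ℂ 2 (volume : Measure E3)

/-- `L²(ℝ³; ℝ)`. -/
abbrev L2R : Type := Lp ℝ 2 (volume : Measure E3)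

/-- The inclusion `L²(ℝ³; ℝ) → L²(ℝ³; ℂ)`. -/
def toC (f : L2R) : L2C := Complex.ofRealCLM.compLp f

/-- The `k`-th standard basis vector of `ℝ³`. -/
def basisVec (k : Fin 3) : E3 := EuclideanSpace.single k 1

/-! ### Functions as tempered distributions -/

/-- The tempered distribution `T` is (integration against) the function `f`. -/
def IsFunction (T : TD) (f : E3 → ℂ) : Prop :=
  LocallyIntegrable f volume ∧
    ∀ h : 𝓢(E3, ℂ), Integrable (fun x => h x * f x) volume ∧ T h = ∫ x, h x * f x

/-- The Fourier transform of `u` is the function `f`. -/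
def HasFourierFunction (u : TD) (f : E3 → ℂ) : Prop := IsFunction (𝓕 u) f

/-! ### Sobolev norms -/

/-- The norm of the inhomogeneous Sobolev space `H^σ(ℝ³)`: the `L²` norm of the Bessel potential
`𝓕⁻¹ (1 + |ξ|²)^(σ/2) 𝓕 u` of `u`, and `∞` if `u` is not in `H^σ`. -/
def sobNorm (σ : ℝ) (u : TD) : ℝ≥0∞ :=
  ⨅ (f : L2C) (_ : besselPotential E3 ℂ σ u = Lp.toTemperedDistribution f), ‖f‖ₑ

/-- The norm `‖ |2πξ|^σ û ‖_{L²}` of the homogeneous Sobolev space of order `σ` on `ℝ³`,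
where `û` has to be a function; it is `∞` if `û` is not a function or if `|ξ|^σ û` is not
square integrable. With the normalisation `e^{-2πi x·ξ}` of the Fourier transform, `2π|ξ|` is the
symbol of `|∇|`. -/
def homNorm (σ : ℝ) (u : TD) : ℝ≥0∞ :=
  ⨅ (f : E3 → ℂ) (_ : HasFourierFunction u f),
    eLpNorm (fun ξ => (((2 * Real.pi * ‖ξ‖) ^ σ : ℝ) : ℂ) * f ξ) 2 volume

/-! ### Conjugates, imaginary parts and products of distributions -/

/-- Complex conjugation of Schwartz functions. -/
def conjSchwartz : 𝓢(E3, ℂ) →L[ℝ] 𝓢(E3, ℂ) :=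
  SchwartzMap.postcompCLM (Complex.conjCLE : ℂ →L[ℝ] ℂ)

/-- The complex conjugate of a tempered distribution: `⟨conj T, h⟩ = conj ⟨T, conj h⟩`. -/
def conjTD (T : TD) : TD :=
  ContinuousLinearMap.toPointwiseConvergenceCLM _ _ _ _
    ({ toFun := fun h => (starRingEnd ℂ) (T (conjSchwartz h))
       map_add' := fun h₁ h₂ => by simp
       map_smul' := fun c h => by
         have hc : conjSchwartz (c • h) = (starRingEnd ℂ) c • conjSchwartz h := by
           ext x
           simp [conjSchwartz]
         simp [hc]
       cont := Complex.continuous_conj.comp (T.cont.comp conjSchwartz.cont) } :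
      𝓢(E3, ℂ) →L[ℂ] ℂ)

/-- The imaginary part `(T - conj T) / 2i` of a tempered distribution. -/
def imTD (T : TD) : TD := (1 / (2 * Complex.I) : ℂ) • (T - conjTD T)

/-- `w` is the product of the tempered distributions `u` and `v`: the Fourier transforms of `u`, `v`
are functions `û`, `v̂` whose convolution converges absolutely at almost every point, and the
Fourier transform of `w` is the function `û * v̂`. For `u ∈ H^s`, `v ∈ H^{s-1}`, `s ≥ 1/2`, this is
the unique continuous extension of the pointwise product of Schwartz functions. -/
def IsProduct (u v w : TD) : Prop :=
  ∃ f g : E3 → ℂ, HasFourierFunction u f ∧ HasFourierFunction v g ∧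
    (∀ᵐ ξ : E3, Integrable (fun η => f η * g (ξ - η)) volume) ∧
    HasFourierFunction w (fun ξ => ∫ η, f η * g (ξ - η))

/-- `G = (1 - P) N`, where `1 - P = Δ⁻¹ ∇ (∇ · )` is the projection onto gradients (`P` is the Leray
projection). It is the matrix Fourier multiplier `ξ_j ξ_k / |ξ|²`, applied to vector fields whose
Fourier transforms are functions. -/
def IsGradientPart (N G : Fin 3 → TD) : Prop :=
  ∃ n : Fin 3 → E3 → ℂ, (∀ k, HasFourierFunction (N k) (n k)) ∧
    ∀ j, HasFourierFunction (G j)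
      (fun ξ => ∑ k, ((ξ j * ξ k / ‖ξ‖ ^ 2 : ℝ) : ℂ) * n k ξ)

/-! ### The elliptic system -/

/-- The first equation `(-Δ + |φ|²) A₀ = Im (φ conj φ_t)` of the elliptic system, as an equation of
tempered distributions for a real function `A₀`. -/
def EllipticEq (φ : L2C) (φt A0 : TD) : Prop :=
  ∃ (a : E3 → ℝ) (V p : TD),
    IsFunction A0 (fun x => (a x : ℂ)) ∧
    IsFunction V (fun x => ((‖φ x‖ ^ 2 * a x : ℝ) : ℂ)) ∧
    IsProduct φ (conjTD φt) p ∧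
    -(Δ A0) + V = imTD p

/-- The second equation `∇ A_{0,t} = -(1 - P) Im (φ conj ∇φ) + (1 - P) (A |φ|²)` of the elliptic
system, as an equation of tempered distributions. -/
def GradientEq (φ : L2C) (A : Fin 3 → L2R) (A0t : L2R) : Prop :=
  ∃ q W : Fin 3 → TD,
    (∀ k, IsProduct φ (conjTD (∂_{basisVec k} (φ : TD))) (q k)) ∧
    (∀ k, IsFunction (W k) (fun x => ((A k x * ‖φ x‖ ^ 2 : ℝ) : ℂ))) ∧
    IsGradientPart (fun k => -imTD (q k) + W k) (fun j => ∂_{basisVec j} (toC A0t : TD))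

/-- `(A₀, A_{0,t})` solves the elliptic system with data `φ, A, φ_t`, where `A₀` is a real function
in the homogeneous space `Ḣ¹` and `A_{0,t}` is a real function in `L²`. -/
structure IsSolution (φ : L2C) (A : Fin 3 → L2R) (φt A0 : TD) (A0t : L2R) : Prop where
  finite_norm : homNorm 1 A0 < ∞
  elliptic : EllipticEq φ φt A0
  gradient : GradientEq φ A A0t

/-! ### The data -/

/-- `φ, A ∈ H^s` and `φ_t ∈ H^{s-1}`. -/
structure IsData (s : ℝ) (φ : L2C) (A : Fin 3 → L2R) (φt : TD) : Prop where
  phi : MemSobolev s 2 (φ : TD)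
  vec : ∀ k, MemSobolev s 2 (toC (A k) : TD)
  phit : MemSobolev (s - 1) 2 φt

/-- The `H^s` norm of a vector field. -/
def vecSobNorm (s : ℝ) (A : Fin 3 → L2R) : ℝ≥0∞ :=
  (∑ k, sobNorm s (toC (A k) : TD) ^ 2) ^ (1 / 2 : ℝ)

/-- `‖φ‖_{H^s} + ‖A‖_{H^s} + ‖φ_t‖_{H^{s-1}}`. -/
def dataNorm (s : ℝ) (φ : L2C) (A : Fin 3 → L2R) (φt : TD) : ℝ≥0∞ :=
  sobNorm s (φ : TD) + vecSobNorm s A + sobNorm (s - 1) φt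

end MKG

end

/-!
Everything happens on the Fourier side. An element of `H^s` is recorded by the `L²` function
`⟨ξ⟩^s û`, an element of `Ḣ^{±1}` by `(2π|ξ|)^{±1} û` (`HasWeight`), so that all norms of the
statement are norms of `L²`. Each product that occurs, `H^s × H^(s-1) → Ḣ⁻¹`, `H^s × Ḣ¹ → L²`,
`H^s × H^s → L²` and `H^s × L² → Ḣ⁻¹`, then becomes a bilinear operator
`∫ k(ξ, η) F(η) G(ξ - η) dη` on `L²`. Its kernel is at most `w(ξ) + w(η) + w(ξ - η)` with
`w(ξ) = 2 |ξ|⁻¹ ⟨ξ⟩^(1 - 2s)` (`enorm_le_wt_add_wt`), which is square integrable on `ℝ³` exactly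
because `s > 3/4`, and such operators are bounded on `L²` by the Cauchy-Schwarz and Young
inequalities (`eLpNorm_kernel_le`).

The products in the equations are partly pointwise and partly convolutions of Fourier transforms.
They agree for a fixed factor `v ∈ L² + 𝓕⁻¹ L¹` and `u ∈ L²`, since after testing with a Schwartz
function both are continuous in `u` and Schwartz functions are dense
(`IsMultiplicand.integral_fourier_mul`). Elements of `Ḣ¹` are of the form `v`, as the low
frequencies of their Fourier transform are integrable (`exists_isMultiplicand_hw`).

Let `T` be the operator `G ↦ φ A₀`, where `G = |∇| A₀`. The first equation becomes
`(1 + T* T) G = N` with `N` in `L²` (`EllipticEq.ellOp_eq`), where the adjoint `T*` is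
multiplication by `conj φ` (`inner_dual`). The operator `1 + T* T` is invertible and satisfies
`‖G‖ ≤ ‖(1 + T* T) G‖` (`ellOp_surjective`, `norm_le_norm_ellOp`), which gives
existence, uniqueness and the first bound. The second equation is solved by Riesz transforms
(`IsGradientPart.fourier_eq`). That the solutions are real is a symmetry under `F ↦ conj F(-·)`:
for `G` it follows from uniqueness, for `A_{0,t}` from the symmetry of the symbols. Multilinearity
of the source terms, together with the linear equation for the difference of two solutions, gives
the Lipschitz bounds (`norm_potential_sub_le`, `norm_gradPotential_gradSource_sub_le`).
-/

open MeasureTheory TemperedDistribution FourierTransform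
open scoped SchwartzMap ENNReal NNReal LineDeriv Laplacian

noncomputable section

namespace MKG

/-! ### Tempered distributions given by functions -/

/-- A function that is integrable against every Schwartz function is locally integrable. -/
theorem locallyIntegrable_of_schwartz {f : E3 → ℂ}
    (hf : ∀ h : 𝓢(E3, ℂ), Integrable (fun x => h x * f x) volume) :
    LocallyIntegrable f volume := by
  rw [locallyIntegrable_iff]
  intro K hK
  obtain ⟨R, hR, hKR⟩ := hK.isBounded.subset_closedBall_lt 0 (0 : E3)
  let b : ContDiffBump (0 : E3) := ⟨R, R + 1, hR, by linarith⟩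
  have hb₁ : HasCompactSupport (Complex.ofRealCLM ∘ b) := b.hasCompactSupport.comp_left rfl
  have hb₂ : ContDiff ℝ ((⊤ : ℕ∞) : WithTop ℕ∞) (Complex.ofRealCLM ∘ b) :=
    Complex.ofRealCLM.contDiff.comp b.contDiff
  have := (hf (hb₁.toSchwartzMap hb₂)).integrableOn (s := K)
  refine this.congr_fun (fun x hx => ?_) hK.measurableSet
  have : b x = 1 := b.one_of_mem_closedBall (hKR hx)
  simp [this]

theorem isFunction_of_forall {T : TD} {f : E3 → ℂ}
    (h : ∀ h : 𝓢(E3, ℂ), Integrable (fun x => h x * f x) volume ∧ T h = ∫ x, h x * f x) :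
    IsFunction T f :=
  ⟨locallyIntegrable_of_schwartz fun g => (h g).1, h⟩

theorem IsFunction.ae_eq {T : TD} {f g : E3 → ℂ} (hf : IsFunction T f) (hg : IsFunction T g) :
    f =ᵐ[volume] g := by
  refine ae_eq_of_integral_contDiff_smul_eq hf.1 hg.1 fun b hb₁ hb₂ => ?_
  have h₁ : HasCompactSupport (Complex.ofRealCLM ∘ b) := hb₂.comp_left rfl
  have h₂ : ContDiff ℝ ((⊤ : ℕ∞) : WithTop ℕ∞) (Complex.ofRealCLM ∘ b) :=
    Complex.ofRealCLM.contDiff.comp hb₁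
  have := ((hf.2 (h₁.toSchwartzMap h₂)).2).symm.trans (hg.2 (h₁.toSchwartzMap h₂)).2
  simpa using this

theorem IsFunction.congr {T : TD} {f g : E3 → ℂ} (hf : IsFunction T f) (h : f =ᵐ[volume] g) :
    IsFunction T g := by
  refine ⟨hf.1.congr h, fun k => ?_⟩
  have : (fun x => k x * f x) =ᵐ[volume] fun x => k x * g x := by
    filter_upwards [h] with x hx
    rw [hx]
  exact ⟨(hf.2 k).1.congr this, (hf.2 k).2.trans (integral_congr_ae this)⟩

theorem IsFunction.ext {T T' : TD} {f g : E3 → ℂ} (hf : IsFunction T f) (hg : IsFunction T' g)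
    (h : f =ᵐ[volume] g) : T = T' := by
  ext k
  rw [((hf.congr h).2 k).2, (hg.2 k).2]

theorem IsFunction.add {T T' : TD} {f g : E3 → ℂ} (hf : IsFunction T f) (hg : IsFunction T' g) :
    IsFunction (T + T') (fun x => f x + g x) := by
  refine isFunction_of_forall fun k => ?_
  have : (fun x => k x * (f x + g x)) = (fun x => k x * f x) + fun x => k x * g x := by
    ext x; simp [mul_add]
  rw [this]
  refine ⟨(hf.2 k).1.add (hg.2 k).1, ?_⟩
  rw [integral_add' (hf.2 k).1 (hg.2 k).1, ← (hf.2 k).2, ← (hg.2 k).2]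
  simp

theorem IsFunction.smul {T : TD} {f : E3 → ℂ} (hf : IsFunction T f) (c : ℂ) :
    IsFunction (c • T) (fun x => c * f x) := by
  refine isFunction_of_forall fun k => ?_
  have : (fun x => k x * (c * f x)) = fun x => c * (k x * f x) := by
    ext x; ring
  rw [this]
  refine ⟨(hf.2 k).1.const_mul c, ?_⟩
  rw [integral_const_mul, ← (hf.2 k).2]
  simp

theorem isFunction_Lp {p : ℝ≥0∞} [hp : Fact (1 ≤ p)] (f : Lp ℂ p (volume : Measure E3)) :
    IsFunction (f : TD) f := by
  refine isFunction_of_forall fun k => ⟨?_, by simp⟩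
  have := ENNReal.HolderConjugate.inv_one_sub_inv' hp.out
  exact (k.memLp (1 - p⁻¹)⁻¹ volume).integrable_mul (Lp.memLp f)

theorem exists_isFunction_of_memLp {p : ℝ≥0∞} [hp : Fact (1 ≤ p)] {f : E3 → ℂ}
    (hf : MemLp f p volume) : ∃ T : TD, IsFunction T f :=
  ⟨_, (isFunction_Lp (hf.toLp f)).congr hf.coeFn_toLp⟩

theorem IsFunction.smulLeft {T : TD} {f : E3 → ℂ} (hf : IsFunction T f) {g : E3 → ℂ}
    (hg : g.HasTemperateGrowth) : IsFunction (smulLeftCLM ℂ g T) (fun x => g x * f x) := by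
  refine isFunction_of_forall fun k => ?_
  have h := hf.2 (SchwartzMap.smulLeftCLM ℂ g k)
  have e : (fun x => (SchwartzMap.smulLeftCLM ℂ g k) x * f x) = fun x => k x * (g x * f x) := by
    ext x
    rw [SchwartzMap.smulLeftCLM_apply_apply hg, smul_eq_mul]
    ring
  rw [e] at h
  exact h

/-! ### Fourier transforms that are functions -/

theorem HasFourierFunction.ae_eq {u : TD} {f g : E3 → ℂ} (hf : HasFourierFunction u f)
    (hg : HasFourierFunction u g) : f =ᵐ[volume] g :=
  IsFunction.ae_eq hf hg

theorem HasFourierFunction.congr {u : TD} {f g : E3 → ℂ} (hf : HasFourierFunction u f)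
    (h : f =ᵐ[volume] g) : HasFourierFunction u g :=
  IsFunction.congr hf h

theorem HasFourierFunction.ext {u v : TD} {f g : E3 → ℂ} (hf : HasFourierFunction u f)
    (hg : HasFourierFunction v g) (h : f =ᵐ[volume] g) : u = v := by
  have := congrArg (fun T : TD => 𝓕⁻ T) (IsFunction.ext hf hg h)
  simpa using this

theorem HasFourierFunction.add {u v : TD} {f g : E3 → ℂ} (hf : HasFourierFunction u f)
    (hg : HasFourierFunction v g) : HasFourierFunction (u + v) (fun ξ => f ξ + g ξ) := by
  unfold HasFourierFunction at *
  rw [FourierTransform.fourier_add]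
  exact hf.add hg

theorem HasFourierFunction.smul {u : TD} {f : E3 → ℂ} (hf : HasFourierFunction u f) (c : ℂ) :
    HasFourierFunction (c • u) (fun ξ => c * f ξ) := by
  unfold HasFourierFunction at *
  rw [FourierTransform.fourier_smul]
  exact IsFunction.smul hf c

theorem HasFourierFunction.neg {u : TD} {f : E3 → ℂ} (hf : HasFourierFunction u f) :
    HasFourierFunction (-u) (fun ξ => -f ξ) := by
  have e : -u = (-1 : ℂ) • u := by ext h; simp
  rw [e]
  simpa only [neg_one_mul] using hf.smul (-1)

theorem HasFourierFunction.sub {u v : TD} {f g : E3 → ℂ} (hf : HasFourierFunction u f)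
    (hg : HasFourierFunction v g) : HasFourierFunction (u - v) (fun ξ => f ξ - g ξ) := by
  simpa [sub_eq_add_neg] using hf.add hg.neg

theorem IsFunction.fourierInv {T : TD} {f : E3 → ℂ} (hf : IsFunction T f) :
    HasFourierFunction (𝓕⁻ T) f := by
  unfold HasFourierFunction
  simpa using hf

theorem hasFourierFunction_L2 (f : L2C) : HasFourierFunction (f : TD) (𝓕 f : L2C) := by
  unfold HasFourierFunction
  rw [Lp.fourier_toTemperedDistribution_eq]
  exact isFunction_Lp _

theorem hasFourierFunction_fourierInv_L2 (f : L2C) :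
    HasFourierFunction ((𝓕⁻ f : L2C) : TD) f := by
  have := hasFourierFunction_L2 (𝓕⁻ f : L2C)
  rwa [FourierTransform.fourier_fourierInv_eq] at this

theorem HasFourierFunction.multiplier {u : TD} {f : E3 → ℂ} (hf : HasFourierFunction u f)
    {g : E3 → ℂ} (hg : g.HasTemperateGrowth) :
    HasFourierFunction (fourierMultiplierCLM ℂ g u) (fun ξ => g ξ * f ξ) := by
  rw [fourierMultiplierCLM_apply]
  exact (IsFunction.smulLeft hf hg).fourierInv

theorem HasFourierFunction.laplacian {u : TD} {f : E3 → ℂ} (hf : HasFourierFunction u f) :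
    HasFourierFunction (Δ u) (fun ξ => -((2 * Real.pi * ‖ξ‖ : ℝ) : ℂ) ^ 2 * f ξ) := by
  rw [laplacian_eq_fourierMultiplierCLM]
  have := (hf.multiplier (g := fun x ↦ Complex.ofReal (‖x‖ ^ 2)) (by fun_prop)).smul
    ((-(2 * Real.pi) ^ 2 : ℝ) : ℂ)
  have e (T : TD) : (-(2 * Real.pi) ^ 2 : ℝ) • T = ((-(2 * Real.pi) ^ 2 : ℝ) : ℂ) • T := by
    ext h; simp
  rw [e]
  refine this.congr (.of_forall fun ξ => ?_)
  push_cast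
  ring

theorem HasFourierFunction.deriv {u : TD} {f : E3 → ℂ} (hf : HasFourierFunction u f) (k : Fin 3) :
    HasFourierFunction (∂_{basisVec k} u)
      (fun ξ => 2 * Real.pi * Complex.I * (ξ k : ℂ) * f ξ) := by
  rw [lineDeriv_eq_fourierMultiplierCLM]
  have := (hf.multiplier (g := fun x ↦ ((inner ℝ x (basisVec k) : ℝ) : ℂ)) (by fun_prop)).smul
    (2 * Real.pi * Complex.I)
  refine this.congr (.of_forall fun ξ => ?_)
  simp [basisVec, EuclideanSpace.inner_single_right]
  ring

/-! ### Complex conjugation -/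

@[simp]
theorem conjSchwartz_apply (h : 𝓢(E3, ℂ)) (x : E3) :
    conjSchwartz h x = (starRingEnd ℂ) (h x) := rfl

theorem conjTD_apply (T : TD) (h : 𝓢(E3, ℂ)) :
    conjTD T h = (starRingEnd ℂ) (T (conjSchwartz h)) := rfl

theorem IsFunction.conj {T : TD} {f : E3 → ℂ} (hf : IsFunction T f) :
    IsFunction (conjTD T) (fun x => (starRingEnd ℂ) (f x)) := by
  refine isFunction_of_forall fun k => ?_
  have h := hf.2 (conjSchwartz k)
  have e : (fun x => k x * (starRingEnd ℂ) (f x)) =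
      fun x => (starRingEnd ℂ) (conjSchwartz k x * f x) := by
    ext x; simp
  rw [e]
  refine ⟨(Complex.conjCLE : ℂ →L[ℝ] ℂ).integrable_comp h.1, ?_⟩
  rw [conjTD_apply, h.2, integral_conj]

/-- The reflection `h(-x)` of a Schwartz function. -/
def reflSchwartz : 𝓢(E3, ℂ) →L[ℂ] 𝓢(E3, ℂ) :=
  SchwartzMap.compCLMOfContinuousLinearEquiv ℂ (ContinuousLinearEquiv.neg ℝ)

@[simp]
theorem reflSchwartz_apply (h : 𝓢(E3, ℂ)) (x : E3) : reflSchwartz h x = h (-x) := by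
  simp [reflSchwartz]

theorem conjSchwartz_fourier (h : 𝓢(E3, ℂ)) :
    conjSchwartz (𝓕 h) = 𝓕 (reflSchwartz (conjSchwartz h)) := by
  ext ξ
  rw [conjSchwartz_apply, SchwartzMap.fourier_coe, SchwartzMap.fourier_coe, Real.fourier_eq,
    Real.fourier_eq, ← integral_conj, ← integral_neg_eq_self]
  congr 1
  ext x
  simp only [Circle.smul_def, smul_eq_mul, map_mul, reflSchwartz_apply, conjSchwartz_apply, neg_neg,
    inner_neg_left]
  rw [← Circle.coe_inv_eq_conj, ← AddChar.map_neg_eq_inv]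

theorem HasFourierFunction.conj {u : TD} {f : E3 → ℂ} (hf : HasFourierFunction u f) :
    HasFourierFunction (conjTD u) (fun ξ => (starRingEnd ℂ) (f (-ξ))) := by
  refine isFunction_of_forall fun k => ?_
  have h := hf.2 (reflSchwartz (conjSchwartz k))
  have e : (fun x => k x * (starRingEnd ℂ) (f (-x))) =
      fun x => (starRingEnd ℂ) (reflSchwartz (conjSchwartz k) (-x) * f (-x)) := by
    ext x; simp
  rw [e]
  refine ⟨(Complex.conjCLE : ℂ →L[ℝ] ℂ).integrable_comp h.1.comp_neg, ?_⟩
  rw [TemperedDistribution.fourier_apply, conjTD_apply, conjSchwartz_fourier,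
    ← TemperedDistribution.fourier_apply, h.2, integral_conj,
    integral_neg_eq_self (fun x => reflSchwartz (conjSchwartz k) x * f x)]

theorem conjTD_conjTD (T : TD) : conjTD (conjTD T) = T := by
  ext h
  have : conjSchwartz (conjSchwartz h) = h := by ext x; simp
  simp [conjTD_apply, this]

theorem conjTD_sub (S T : TD) : conjTD (S - T) = conjTD S - conjTD T := by
  ext h
  simp [conjTD_apply]

theorem conjTD_add (S T : TD) : conjTD (S + T) = conjTD S + conjTD T := by
  ext h
  simp [conjTD_apply]

theorem conjTD_smul (c : ℂ) (T : TD) : conjTD (c • T) = (starRingEnd ℂ) c • conjTD T := by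
  ext h
  simp [conjTD_apply]

theorem conjTD_imTD (T : TD) : conjTD (imTD T) = imTD T := by
  rw [imTD, conjTD_smul, conjTD_sub, conjTD_conjTD, ← neg_sub T, smul_neg, ← neg_smul]
  congr 1
  simp [Complex.conj_ofNat]

theorem HasFourierFunction.im {u : TD} {f : E3 → ℂ} (hf : HasFourierFunction u f) :
    HasFourierFunction (imTD u)
      (fun ξ => 1 / (2 * Complex.I) * (f ξ - (starRingEnd ℂ) (f (-ξ)))) :=
  (hf.sub hf.conj).smul _

/-! ### Bilinear kernel estimates in `L²` -/

theorem eLpNorm_two_eq (F : E3 → ℝ≥0∞) :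
    eLpNorm F 2 volume = (∫⁻ x, F x ^ (2 : ℝ)) ^ (1 / 2 : ℝ) := by
  rw [eLpNorm_eq_lintegral_rpow_enorm_toReal (by norm_num) (by norm_num)]
  simp

theorem lintegral_mul_le_eLpNorm {F G : E3 → ℝ≥0∞} (hF : Measurable F) (hG : Measurable G) :
    ∫⁻ x, F x * G x ≤ eLpNorm F 2 volume * eLpNorm G 2 volume := by
  rw [eLpNorm_two_eq, eLpNorm_two_eq]
  exact ENNReal.lintegral_mul_le_Lp_mul_Lq volume Real.HolderConjugate.two_two hF.aemeasurable
    hG.aemeasurable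

theorem eLpNorm_sub_left (G : E3 → ℝ≥0∞) (ξ : E3) :
    eLpNorm (fun η => G (ξ - η)) 2 volume = eLpNorm G 2 volume := by
  rw [eLpNorm_two_eq, eLpNorm_two_eq, lintegral_sub_left_eq_self (fun x => G x ^ (2 : ℝ)) ξ]

theorem lintegral_convolution_le {F G : E3 → ℝ≥0∞} (hF : Measurable F) (hG : Measurable G)
    (ξ : E3) : ∫⁻ η, F η * G (ξ - η) ≤ eLpNorm F 2 volume * eLpNorm G 2 volume := by
  rw [← eLpNorm_sub_left G ξ]
  exact lintegral_mul_le_eLpNorm hF (by fun_prop)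

theorem measurable_convolution {F G : E3 → ℝ≥0∞} (hF : Measurable F) (hG : Measurable G) :
    Measurable fun ξ => ∫⁻ η, F η * G (ξ - η) := by
  apply Measurable.lintegral_prod_right'
    (f := fun p : E3 × E3 => F p.2 * G (p.1 - p.2))
  fun_prop

/-- Young's inequality `L¹ * L² ⊆ L²`. -/
theorem eLpNorm_convolution_le_left {F G : E3 → ℝ≥0∞} (hF : Measurable F) (hG : Measurable G) :
    eLpNorm (fun ξ => ∫⁻ η, F η * G (ξ - η)) 2 volume ≤
      (∫⁻ η, F η) * eLpNorm G 2 volume := by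
  -- the Cauchy-Schwarz inequality for `F^(1/2)` and `F^(1/2) G(ξ - ·)`
  have key : ∀ ξ, (∫⁻ η, F η * G (ξ - η)) ^ (2 : ℝ) ≤
      (∫⁻ η, F η) * ∫⁻ η, F η * G (ξ - η) ^ (2 : ℝ) := by
    intro ξ
    have h := ENNReal.lintegral_mul_le_Lp_mul_Lq volume Real.HolderConjugate.two_two
      (f := fun η => F η ^ (1 / 2 : ℝ)) (g := fun η => F η ^ (1 / 2 : ℝ) * G (ξ - η))
      (by fun_prop) (by fun_prop)
    have e₁ : ∀ η, F η ^ (1 / 2 : ℝ) * (F η ^ (1 / 2 : ℝ) * G (ξ - η)) = F η * G (ξ - η) := by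
      intro η
      rw [← mul_assoc, ← ENNReal.rpow_add_of_nonneg _ _ (by norm_num) (by norm_num)]
      norm_num
    have e₂ : ∀ η, (F η ^ (1 / 2 : ℝ)) ^ (2 : ℝ) = F η := by
      intro η
      rw [← ENNReal.rpow_mul]
      norm_num
    simp only [Pi.mul_apply, e₁, e₂, ENNReal.mul_rpow_of_nonneg _ _ (zero_le_two (α := ℝ))] at h
    calc _ ≤ _ := ENNReal.rpow_le_rpow h (by norm_num)
      _ = _ := by
        rw [ENNReal.mul_rpow_of_nonneg _ _ (by norm_num), ← ENNReal.rpow_mul, ← ENNReal.rpow_mul]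
        norm_num
  have swap : ∫⁻ ξ, ∫⁻ η, F η * G (ξ - η) ^ (2 : ℝ) =
      (∫⁻ η, F η) * ∫⁻ x, G x ^ (2 : ℝ) := by
    rw [lintegral_lintegral_swap (by fun_prop)]
    calc _ = ∫⁻ η, F η * ∫⁻ x, G x ^ (2 : ℝ) := by
          refine lintegral_congr fun η => ?_
          rw [lintegral_const_mul _ (by fun_prop),
            lintegral_sub_right_eq_self (fun x => G x ^ (2 : ℝ)) η]
      _ = _ := lintegral_mul_const _ hF
  rw [eLpNorm_two_eq, eLpNorm_two_eq]
  calc _ ≤ ((∫⁻ η, F η) * ∫⁻ ξ, ∫⁻ η, F η * G (ξ - η) ^ (2 : ℝ)) ^ (1 / 2 : ℝ) := by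
        refine ENNReal.rpow_le_rpow ?_ (by norm_num)
        refine (lintegral_mono key).trans ?_
        rw [lintegral_const_mul _ (measurable_convolution hF (hG.pow_const _))]
    _ = _ := by
        rw [swap, ← mul_assoc, ENNReal.mul_rpow_of_nonneg _ _ (by norm_num), ← sq,
          ← ENNReal.rpow_natCast, ← ENNReal.rpow_mul]
        norm_num

theorem lintegral_convolution_comm (F G : E3 → ℝ≥0∞) (ξ : E3) :
    ∫⁻ η, F η * G (ξ - η) = ∫⁻ η, G η * F (ξ - η) := by
  rw [← lintegral_sub_left_eq_self (fun η => F η * G (ξ - η)) ξ]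
  refine lintegral_congr fun η => ?_
  rw [sub_sub_cancel, mul_comm]

theorem eLpNorm_convolution_le_right {F G : E3 → ℝ≥0∞} (hF : Measurable F) (hG : Measurable G) :
    eLpNorm (fun ξ => ∫⁻ η, F η * G (ξ - η)) 2 volume ≤
      eLpNorm F 2 volume * ∫⁻ η, G η := by
  simp_rw [lintegral_convolution_comm F G]
  rw [mul_comm]
  exact eLpNorm_convolution_le_left hG hF

/-- The bilinear estimate behind all products: if a kernel `K(ξ, η)` is at most
`w(ξ) + w(η) + w(ξ - η)` with `w ∈ L²`, then `∫ K(ξ, η) F(η) G(ξ - η) dη` is bounded on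
`L² × L² → L²`. The first term is estimated by the Cauchy-Schwarz inequality in `η`, the other two
by Young's inequality, as `w F` and `w G` are in `L¹`. -/
theorem eLpNorm_kernel_le {K : E3 → E3 → ℝ≥0∞} {w F G : E3 → ℝ≥0∞} (hw : Measurable w)
    (hF : Measurable F) (hG : Measurable G) (hK : ∀ ξ η, K ξ η ≤ w ξ + w η + w (ξ - η)) :
    eLpNorm (fun ξ => ∫⁻ η, K ξ η * (F η * G (ξ - η))) 2 volume ≤
      3 * eLpNorm w 2 volume * (eLpNorm F 2 volume * eLpNorm G 2 volume) := by
  have m₁ := measurable_convolution hF hG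
  have m₂ := measurable_convolution (hw.mul hF) hG
  have m₃ := measurable_convolution hF (hw.mul hG)
  have n₁ := (hw.mul m₁).aestronglyMeasurable (μ := (volume : Measure E3))
  have n₂ := m₂.aestronglyMeasurable (μ := (volume : Measure E3))
  have n₃ := m₃.aestronglyMeasurable (μ := (volume : Measure E3))
  have h₁ : eLpNorm (fun ξ => w ξ * ∫⁻ η, F η * G (ξ - η)) 2 volume ≤
      eLpNorm w 2 volume * (eLpNorm F 2 volume * eLpNorm G 2 volume) := by
    set c := eLpNorm F 2 volume * eLpNorm G 2 volume
    rw [eLpNorm_two_eq, eLpNorm_two_eq]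
    calc _ ≤ (∫⁻ ξ, w ξ ^ (2 : ℝ) * c ^ (2 : ℝ)) ^ (1 / 2 : ℝ) := by
          gcongr with ξ
          rw [ENNReal.mul_rpow_of_nonneg _ _ (by norm_num)]
          gcongr
          exact lintegral_convolution_le hF hG ξ
      _ = _ := by
          rw [lintegral_mul_const _ (by fun_prop), ENNReal.mul_rpow_of_nonneg _ _ (by norm_num),
            ← ENNReal.rpow_mul]
          norm_num
  have h₂ : eLpNorm (fun ξ => ∫⁻ η, (w * F) η * G (ξ - η)) 2 volume ≤
      eLpNorm w 2 volume * (eLpNorm F 2 volume * eLpNorm G 2 volume) := by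
    refine (eLpNorm_convolution_le_left (hw.mul hF) hG).trans ?_
    rw [← mul_assoc]
    gcongr
    exact lintegral_mul_le_eLpNorm hw hF
  have h₃ : eLpNorm (fun ξ => ∫⁻ η, F η * (w * G) (ξ - η)) 2 volume ≤
      eLpNorm w 2 volume * (eLpNorm F 2 volume * eLpNorm G 2 volume) := by
    refine (eLpNorm_convolution_le_right hF (hw.mul hG)).trans ?_
    rw [mul_left_comm]
    gcongr
    exact lintegral_mul_le_eLpNorm hw hG
  calc _ ≤ eLpNorm ((fun ξ => w ξ * ∫⁻ η, F η * G (ξ - η)) +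
        (fun ξ => ∫⁻ η, (w * F) η * G (ξ - η)) +
        fun ξ => ∫⁻ η, F η * (w * G) (ξ - η)) 2 volume := by
        refine eLpNorm_mono_enorm fun ξ => ?_
        simp only [enorm_eq_self, Pi.add_apply, Pi.mul_apply]
        rw [← lintegral_const_mul _ (by fun_prop), ← lintegral_add_left (by fun_prop),
          ← lintegral_add_left (by fun_prop)]
        refine lintegral_mono fun η => ?_
        calc _ ≤ (w ξ + w η + w (ξ - η)) * (F η * G (ξ - η)) := by gcongr; exact hK ξ η
          _ = _ := by ring
    _ ≤ _ := (eLpNorm_add_le (n₁.add n₂) n₃ (by norm_num)).trans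
        (add_le_add_left (eLpNorm_add_le n₁ n₂ (by norm_num)) _)
    _ ≤ _ := add_le_add (add_le_add h₁ h₂) h₃
    _ = _ := by ring

/-- The convolution of two functions on `ℝ³`. -/
def cv (f g : E3 → ℂ) (ξ : E3) : ℂ := ∫ η, f η * g (ξ - η)

theorem cv_congr {f f' g g' : E3 → ℂ} (hf : f =ᵐ[volume] f') (hg : g =ᵐ[volume] g') (ξ : E3) :
    (fun η => f η * g (ξ - η)) =ᵐ[volume] fun η => f' η * g' (ξ - η) := by
  have := (quasiMeasurePreserving_sub_left (volume : Measure E3) ξ).ae_eq_comp hg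
  filter_upwards [hf, this] with η h₁ h₂
  simp only [Function.comp_apply] at h₂
  rw [h₁, h₂]

theorem cv_congr_apply {f f' g g' : E3 → ℂ} (hf : f =ᵐ[volume] f') (hg : g =ᵐ[volume] g') :
    cv f g = cv f' g' := by
  ext ξ
  exact integral_congr_ae (cv_congr hf hg ξ)

/-- A real kernel dominated by `w(ξ) + w(η) + w(ξ - η)` for some `w ∈ L²`. -/
structure AdmissibleKernel (k : E3 → E3 → ℝ) (w : E3 → ℝ≥0∞) : Prop where
  meas : Measurable (Function.uncurry k)
  meas_weight : Measurable w
  weight_lt : eLpNorm w 2 volume < ∞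
  bound : ∀ ξ η, ‖k ξ η‖ₑ ≤ w ξ + w η + w (ξ - η)

/-- The function `∫ k(ξ, η) F(η) G(ξ - η) dη`. -/
def kernelFun (k : E3 → E3 → ℝ) (F G : E3 → ℂ) (ξ : E3) : ℂ :=
  ∫ η, (k ξ η : ℂ) * (F η * G (ξ - η))

section
variable {k : E3 → E3 → ℝ} {w : E3 → ℝ≥0∞}

theorem L2C.measurable (F : L2C) : Measurable F := (Lp.stronglyMeasurable F).measurable

theorem AdmissibleKernel.eLpNorm_le (hk : AdmissibleKernel k w) (F G : L2C) :
    eLpNorm (fun ξ => ∫⁻ η, ‖(k ξ η : ℂ) * (F η * G (ξ - η))‖ₑ) 2 volume ≤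
      3 * eLpNorm w 2 volume * (‖F‖ₑ * ‖G‖ₑ) := by
  have := eLpNorm_kernel_le (K := fun ξ η => ‖k ξ η‖ₑ) hk.meas_weight (L2C.measurable F).enorm
    (L2C.measurable G).enorm hk.bound
  rw [eLpNorm_enorm, eLpNorm_enorm, ← Lp.enorm_def, ← Lp.enorm_def] at this
  refine le_of_eq_of_le ?_ this
  congr 1
  ext ξ
  refine lintegral_congr fun η => ?_
  rw [enorm_mul, enorm_mul]
  congr 1
  simp [enorm_eq_nnnorm]

theorem AdmissibleKernel.measurable_integrand (hk : AdmissibleKernel k w) (F G : L2C) :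
    Measurable (fun p : E3 × E3 => (k p.1 p.2 : ℂ) * (F p.2 * G (p.1 - p.2))) := by
  have h₁ := L2C.measurable F
  have h₂ := L2C.measurable G
  have h₃ : Measurable fun p : E3 × E3 => k p.1 p.2 := hk.meas
  fun_prop

theorem AdmissibleKernel.lintegral_lt_top (hk : AdmissibleKernel k w) (F G : L2C) :
    ∀ᵐ ξ : E3, ∫⁻ η, ‖(k ξ η : ℂ) * (F η * G (ξ - η))‖ₑ < ∞ := by
  have hm : Measurable fun ξ => ∫⁻ η, ‖(k ξ η : ℂ) * (F η * G (ξ - η))‖ₑ :=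
    (hk.measurable_integrand F G).enorm.lintegral_prod_right'
  have h := (hk.eLpNorm_le F G).trans_lt
    (ENNReal.mul_lt_top (ENNReal.mul_lt_top (by norm_num) hk.weight_lt)
      (ENNReal.mul_lt_top enorm_lt_top enorm_lt_top))
  rw [eLpNorm_two_eq] at h
  have h' : ∫⁻ ξ, (∫⁻ η, ‖(k ξ η : ℂ) * (F η * G (ξ - η))‖ₑ) ^ (2 : ℝ) ≠ ∞ := by
    intro e
    rw [e] at h
    norm_num at h
  filter_upwards [ae_lt_top (hm.pow_const _) h'] with ξ hξ
  exact (ENNReal.rpow_lt_top_iff_of_pos (by norm_num)).1 hξ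

theorem AdmissibleKernel.integrable (hk : AdmissibleKernel k w) (F G : L2C) :
    ∀ᵐ ξ : E3, Integrable (fun η => (k ξ η : ℂ) * (F η * G (ξ - η))) volume := by
  filter_upwards [hk.lintegral_lt_top F G] with ξ hξ
  exact ⟨((hk.measurable_integrand F G).comp measurable_prodMk_left).aestronglyMeasurable, hξ⟩

theorem AdmissibleKernel.eLpNorm_kernelFun_le (hk : AdmissibleKernel k w) (F G : L2C) :
    eLpNorm (kernelFun k F G) 2 volume ≤ 3 * eLpNorm w 2 volume * (‖F‖ₑ * ‖G‖ₑ) := by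
  refine le_trans (eLpNorm_mono_enorm fun ξ => ?_) (hk.eLpNorm_le F G)
  exact enorm_integral_le_lintegral_enorm _

theorem AdmissibleKernel.memLp (hk : AdmissibleKernel k w) (F G : L2C) :
    MemLp (kernelFun k F G) 2 volume := by
  refine ⟨?_, (hk.eLpNorm_kernelFun_le F G).trans_lt
    (ENNReal.mul_lt_top (ENNReal.mul_lt_top (by norm_num) hk.weight_lt)
      (ENNReal.mul_lt_top enorm_lt_top enorm_lt_top))⟩
  exact ((hk.measurable_integrand F G).stronglyMeasurable.integral_prod_right').aestronglyMeasurable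

/-- The bilinear operator on `L²` with an admissible kernel. -/
def AdmissibleKernel.toL2 (hk : AdmissibleKernel k w) (F G : L2C) : L2C := (hk.memLp F G).toLp

theorem AdmissibleKernel.coeFn_toL2 (hk : AdmissibleKernel k w) (F G : L2C) :
    hk.toL2 F G =ᵐ[volume] kernelFun k F G := (hk.memLp F G).coeFn_toLp

/-- The norm bound of the bilinear operators with kernels dominated by `w`; the summand `1`
serves to have `1 ≤ kernelBound w`. -/
def kernelBound (w : E3 → ℝ≥0∞) : ℝ := 3 * (eLpNorm w 2 volume).toReal + 1

theorem one_le_kernelBound (w : E3 → ℝ≥0∞) : 1 ≤ kernelBound w := by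
  unfold kernelBound
  have : 0 ≤ (eLpNorm w 2 volume).toReal := ENNReal.toReal_nonneg
  linarith

theorem AdmissibleKernel.norm_toL2_le (hk : AdmissibleKernel k w) (F G : L2C) :
    ‖hk.toL2 F G‖ ≤ kernelBound w * ‖F‖ * ‖G‖ := by
  have h := hk.eLpNorm_kernelFun_le F G
  have h₁ : ‖hk.toL2 F G‖ ≤ 3 * (eLpNorm w 2 volume).toReal * (‖F‖ * ‖G‖) := by
    rw [AdmissibleKernel.toL2, Lp.norm_toLp]
    have := ENNReal.toReal_mono (ENNReal.mul_lt_top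
      (ENNReal.mul_lt_top (by norm_num) hk.weight_lt)
      (ENNReal.mul_lt_top enorm_lt_top enorm_lt_top)).ne h
    simpa using this
  refine h₁.trans ?_
  rw [mul_assoc (kernelBound w)]
  refine mul_le_mul_of_nonneg_right ?_ (by positivity)
  unfold kernelBound
  linarith

theorem AdmissibleKernel.toL2_add_left (hk : AdmissibleKernel k w) (F F' G : L2C) :
    hk.toL2 (F + F') G = hk.toL2 F G + hk.toL2 F' G := by
  refine Lp.ext ?_
  filter_upwards [hk.coeFn_toL2 (F + F') G, hk.coeFn_toL2 F G, hk.coeFn_toL2 F' G,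
    Lp.coeFn_add (hk.toL2 F G) (hk.toL2 F' G), hk.integrable F G, hk.integrable F' G]
    with ξ h₁ h₂ h₃ h₄ h₅ h₆
  rw [h₄, Pi.add_apply, h₁, h₂, h₃, kernelFun, kernelFun, kernelFun, ← integral_add h₅ h₆]
  refine integral_congr_ae ?_
  filter_upwards [Lp.coeFn_add F F'] with η hη
  rw [hη, Pi.add_apply]
  ring

theorem AdmissibleKernel.toL2_smul_left (hk : AdmissibleKernel k w) (c : ℂ) (F G : L2C) :
    hk.toL2 (c • F) G = c • hk.toL2 F G := by
  refine Lp.ext ?_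
  filter_upwards [hk.coeFn_toL2 (c • F) G, hk.coeFn_toL2 F G, Lp.coeFn_smul c (hk.toL2 F G)]
    with ξ h₁ h₂ h₃
  rw [h₃, Pi.smul_apply, h₁, h₂, kernelFun, kernelFun, smul_eq_mul, ← integral_const_mul]
  refine integral_congr_ae ?_
  filter_upwards [Lp.coeFn_smul c F] with η hη
  rw [hη, Pi.smul_apply, smul_eq_mul]
  ring

theorem AdmissibleKernel.toL2_add_right (hk : AdmissibleKernel k w) (F G G' : L2C) :
    hk.toL2 F (G + G') = hk.toL2 F G + hk.toL2 F G' := by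
  refine Lp.ext ?_
  filter_upwards [hk.coeFn_toL2 F (G + G'), hk.coeFn_toL2 F G, hk.coeFn_toL2 F G',
    Lp.coeFn_add (hk.toL2 F G) (hk.toL2 F G'), hk.integrable F G, hk.integrable F G']
    with ξ h₁ h₂ h₃ h₄ h₅ h₆
  rw [h₄, Pi.add_apply, h₁, h₂, h₃, kernelFun, kernelFun, kernelFun, ← integral_add h₅ h₆]
  refine integral_congr_ae ?_
  have := (quasiMeasurePreserving_sub_left (volume : Measure E3) ξ).ae_eq_comp (Lp.coeFn_add G G')
  filter_upwards [this] with η hη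
  simp only [Function.comp_apply, Pi.add_apply] at hη
  rw [hη]
  ring

theorem AdmissibleKernel.toL2_smul_right (hk : AdmissibleKernel k w) (c : ℂ) (F G : L2C) :
    hk.toL2 F (c • G) = c • hk.toL2 F G := by
  refine Lp.ext ?_
  filter_upwards [hk.coeFn_toL2 F (c • G), hk.coeFn_toL2 F G, Lp.coeFn_smul c (hk.toL2 F G)]
    with ξ h₁ h₂ h₃
  rw [h₃, Pi.smul_apply, h₁, h₂, kernelFun, kernelFun, smul_eq_mul, ← integral_const_mul]
  refine integral_congr_ae ?_
  have := (quasiMeasurePreserving_sub_left (volume : Measure E3) ξ).ae_eq_comp (Lp.coeFn_smul c G)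
  filter_upwards [this] with η hη
  simp only [Function.comp_apply, Pi.smul_apply, smul_eq_mul] at hη
  rw [hη]
  ring

/-- The bilinear operator on `L²` with an admissible kernel, as a bounded bilinear map. -/
def AdmissibleKernel.op (hk : AdmissibleKernel k w) : L2C →L[ℂ] L2C →L[ℂ] L2C :=
  LinearMap.mkContinuous₂
    (LinearMap.mk₂ ℂ hk.toL2 hk.toL2_add_left hk.toL2_smul_left hk.toL2_add_right
      hk.toL2_smul_right)
    (kernelBound w) fun F G => hk.norm_toL2_le F G

theorem AdmissibleKernel.coeFn_op (hk : AdmissibleKernel k w) (F G : L2C) :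
    hk.op F G =ᵐ[volume] kernelFun k F G := hk.coeFn_toL2 F G

theorem AdmissibleKernel.norm_op_le (hk : AdmissibleKernel k w) (F G : L2C) :
    ‖hk.op F G‖ ≤ kernelBound w * ‖F‖ * ‖G‖ := hk.norm_toL2_le F G

/-- The telescoped difference of two values of a bilinear kernel operator. -/
theorem AdmissibleKernel.norm_op_sub_le (hk : AdmissibleKernel k w) (F F' G G' : L2C) :
    ‖hk.op F G - hk.op F' G'‖ ≤ kernelBound w * (‖F - F'‖ * ‖G‖ + ‖F'‖ * ‖G - G'‖) := by
  have e : hk.op F G - hk.op F' G' = hk.op (F - F') G + hk.op F' (G - G') := by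
    simp only [map_sub, _root_.sub_apply]
    abel
  rw [e]
  calc _ ≤ _ := norm_add_le _ _
    _ ≤ _ := add_le_add (hk.norm_op_le _ _) (hk.norm_op_le _ _)
    _ = _ := by ring

end

/-! ### Weights and kernels -/

/-- The power `⟨x⟩^t` of the Japanese bracket `⟨x⟩ = (1 + |x|²)^(1/2)`. -/
def jp (t : ℝ) (x : E3) : ℝ := (1 + ‖x‖ ^ 2) ^ (t / 2)

/-- The homogeneous weight `(2π|ξ|)^σ`, the symbol of `|∇|^σ`. Its value at the origin is `0` for
`σ ≠ 0`, also for negative `σ`. -/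
def hw (σ : ℝ) (ξ : E3) : ℝ := (2 * Real.pi * ‖ξ‖) ^ σ

theorem jp_pos (t : ℝ) (x : E3) : 0 < jp t x := by unfold jp; positivity

theorem jp_add (t r : ℝ) (x : E3) : jp (t + r) x = jp t x * jp r x := by
  unfold jp
  rw [add_div, Real.rpow_add (by positivity)]

theorem jp_neg_mul (t : ℝ) (x : E3) : jp (-t) x * jp t x = 1 := by
  rw [← jp_add]; simp [jp]

@[simp] theorem jp_neg_arg (t : ℝ) (x : E3) : jp t (-x) = jp t x := by simp [jp]

@[simp] theorem hw_neg_arg (σ : ℝ) (x : E3) : hw σ (-x) = hw σ x := by simp [hw]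

@[fun_prop] theorem measurable_jp (t : ℝ) : Measurable (jp t) := by unfold jp; fun_prop

@[fun_prop] theorem measurable_hw (σ : ℝ) : Measurable (hw σ) := by unfold hw; fun_prop

theorem hasTemperateGrowth_jp (t : ℝ) :
    Function.HasTemperateGrowth (fun x : E3 => (jp t x : ℂ)) := by
  unfold jp; fun_prop

theorem hw_pos (σ : ℝ) {x : E3} (hx : x ≠ 0) : 0 < hw σ x := by
  have := norm_pos_iff.2 hx
  unfold hw; positivity

theorem hw_nonneg (σ : ℝ) (x : E3) : 0 ≤ hw σ x := by unfold hw; positivity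

theorem hw_one (x : E3) : hw 1 x = 2 * Real.pi * ‖x‖ := by simp [hw]

theorem hw_neg_one (x : E3) : hw (-1) x = (2 * Real.pi * ‖x‖)⁻¹ := by simp [hw, Real.rpow_neg_one]

theorem hw_mul_hw_neg (σ : ℝ) {x : E3} (hx : x ≠ 0) : hw σ x * hw (-σ) x = 1 := by
  have := norm_pos_iff.2 hx
  unfold hw
  rw [← Real.rpow_add (by positivity)]
  simp

theorem ae_ne_zero : ∀ᵐ x : E3, x ≠ 0 := by simp [ae_iff]

theorem hw_neg_one_le (x : E3) : hw (-1) x ≤ ‖x‖⁻¹ := by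
  rw [hw_neg_one, mul_inv]
  have : (2 * Real.pi)⁻¹ ≤ 1 := inv_le_one_of_one_le₀ (by nlinarith [Real.pi_gt_three])
  exact mul_le_of_le_one_left (by positivity) this

/-- The square integrable function that dominates all kernels: `2 |x|⁻¹ ⟨x⟩^(1 - 2s)`. It takes
the value `∞` at the origin. -/
def wt (s : ℝ) (x : E3) : ℝ≥0∞ := ‖x‖ₑ⁻¹ * ENNReal.ofReal (2 * jp (1 - 2 * s) x)

theorem measurable_wt (s : ℝ) : Measurable (wt s) := by unfold wt; fun_prop

theorem wt_zero (s : ℝ) : wt s 0 = ∞ := by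
  have : 0 < jp (1 - 2 * s) 0 := jp_pos _ _
  simp [wt, ENNReal.top_mul, this]

theorem wt_eq (s : ℝ) {x : E3} (hx : x ≠ 0) :
    wt s x = ENNReal.ofReal (‖x‖⁻¹ * (2 * jp (1 - 2 * s) x)) := by
  have := norm_pos_iff.2 hx
  rw [wt, ENNReal.ofReal_mul (p := ‖x‖⁻¹) (by positivity), ENNReal.ofReal_inv_of_pos this,
    ofReal_norm]

/-- The dominating weight is square integrable: at the origin because `2 < 3`, at infinity because
`4s > 3`. -/
theorem eLpNorm_wt_lt_top {s : ℝ} (hs : 3 / 4 < s) : eLpNorm (wt s) 2 volume < ∞ := by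
  have h₁ : Integrable (fun y : ℝ => 4 * (1 + ‖y‖ ^ 2) ^ (-(2 * (2 * s - 1)) / 2)) volume := by
    refine (integrable_rpow_neg_one_add_norm_sq ?_).const_mul 4
    simp
    linarith
  have h₂ : Integrable
      (fun x : E3 => (‖x‖⁻¹ * (2 * (1 + ‖x‖ ^ 2) ^ ((1 - 2 * s) / 2))) ^ 2) volume := by
    refine (integrable_fun_norm_addHaar (volume : Measure E3)
      (f := fun y : ℝ => (y⁻¹ * (2 * (1 + y ^ 2) ^ ((1 - 2 * s) / 2))) ^ 2)).2 ?_
    refine h₁.integrableOn.congr_fun (fun y hy => ?_) measurableSet_Ioi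
    have hy : (0 : ℝ) < y := hy
    have e : ((1 + y ^ 2) ^ ((1 - 2 * s) / 2)) ^ 2 = (1 + y ^ 2) ^ (-(2 * (2 * s - 1)) / 2) := by
      rw [← Real.rpow_mul_natCast (by positivity)]
      congr 1
      push_cast
      ring
    simp only [finrank_euclideanSpace, Fintype.card_fin, Real.norm_eq_abs, sq_abs, smul_eq_mul]
    rw [mul_pow, mul_pow, e]
    field_simp
    norm_num
  have h₃ := h₂.lintegral_lt_top
  rw [eLpNorm_two_eq]
  refine ENNReal.rpow_lt_top_of_nonneg (by norm_num) (ne_of_lt ?_)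
  refine lt_of_eq_of_lt (lintegral_congr_ae ?_) h₃
  filter_upwards [ae_ne_zero] with x hx
  rw [wt_eq s hx, ENNReal.ofReal_rpow_of_nonneg (by have := jp_pos (1 - 2 * s) x; positivity)
    (by norm_num)]
  congr 1
  norm_num [jp]

section
variable {s : ℝ}

theorem jp_anti {t : ℝ} (ht : t ≤ 0) {x y : E3} (h : ‖x‖ ≤ ‖y‖) : jp t y ≤ jp t x := by
  unfold jp
  exact Real.rpow_le_rpow_of_nonpos (by positivity) (by gcongr) (by linarith)

theorem norm_le_jp_one (x : E3) : ‖x‖ ≤ jp 1 x := by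
  unfold jp
  rw [← Real.sqrt_eq_rpow]
  exact Real.le_sqrt_of_sq_le (by linarith)

theorem jp_le_two_mul {t : ℝ} (ht : 0 ≤ t) (ht1 : t ≤ 1) {x y : E3} (h : ‖x‖ ≤ 2 * ‖y‖) :
    jp t x ≤ 2 * jp t y := by
  have h₁ : jp t x ≤ (2 ^ 2 * (1 + ‖y‖ ^ 2)) ^ (t / 2) := by
    unfold jp
    gcongr
    nlinarith [norm_nonneg x]
  refine h₁.trans ?_
  rw [Real.mul_rpow (by norm_num) (by positivity)]
  refine mul_le_mul_of_nonneg_right ?_ (jp_pos t y).le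
  rw [← Real.rpow_natCast_mul (by norm_num)]
  calc (2 : ℝ) ^ (((2 : ℕ) : ℝ) * (t / 2)) ≤ 2 ^ (1 : ℝ) :=
        Real.rpow_le_rpow_of_exponent_le (by norm_num) (by push_cast; linarith)
    _ = 2 := by norm_num

/-- For `t ≤ 1` the function `|x|⁻¹ ⟨x⟩^t` is decreasing in `|x|`. -/
theorem inv_norm_mul_jp_anti {t : ℝ} (ht1 : t ≤ 1) {x y : E3} (hx : x ≠ 0)
    (h : ‖x‖ ≤ ‖y‖) : ‖y‖⁻¹ * jp t y ≤ ‖x‖⁻¹ * jp t x := by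
  have hx' := norm_pos_iff.2 hx
  have hy' := hx'.trans_le h
  have key : ‖y‖⁻¹ * jp 1 y ≤ ‖x‖⁻¹ * jp 1 x := by
    rw [← div_eq_inv_mul, ← div_eq_inv_mul, div_le_div_iff₀ hy' hx']
    unfold jp
    rw [← Real.sqrt_eq_rpow, ← Real.sqrt_eq_rpow]
    rw [← Real.sqrt_sq hx'.le, ← Real.sqrt_sq hy'.le, ← Real.sqrt_mul (by positivity),
      ← Real.sqrt_mul (by positivity)]
    refine Real.sqrt_le_sqrt ?_
    rw [Real.sq_sqrt (by positivity), Real.sq_sqrt (by positivity)]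
    nlinarith [mul_self_le_mul_self hx'.le h]
  have e : ∀ z, jp t z = jp 1 z * jp (t - 1) z := fun z => by rw [← jp_add]; congr 1; ring
  rw [e, e, ← mul_assoc, ← mul_assoc]
  exact mul_le_mul key (jp_anti (by linarith) h) (jp_pos _ _).le
    (mul_nonneg (by positivity) (jp_pos _ _).le)

theorem enorm_le_wt {a : ℝ} {x : E3} (ha : 0 ≤ a)
    (h : x ≠ 0 → a ≤ ‖x‖⁻¹ * (2 * jp (1 - 2 * s) x)) : ‖a‖ₑ ≤ wt s x := by
  rcases eq_or_ne x 0 with rfl | hx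
  · simp [wt_zero]
  · rw [wt_eq s hx, Real.enorm_eq_ofReal ha]
    exact ENNReal.ofReal_le_ofReal (h hx)

/-- The decisive kernel bound: of the two frequencies `ξ` and `η` the smaller one carries all the
decay. It needs `s ≤ 1`, so that `⟨ξ - η⟩^(1 - s)` is controlled by the larger frequency. -/
theorem enorm_le_wt_add_wt (hs : 3 / 4 < s) (hs1 : s ≤ 1) {ξ η ζ : E3}
    (hζ : ‖ζ‖ ≤ ‖ξ‖ + ‖η‖) :
    ‖hw (-1) ξ * jp (-s) η * jp (1 - s) ζ‖ₑ ≤ wt s ξ + wt s η := by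
  have h0 : 0 ≤ hw (-1) ξ * jp (-s) η * jp (1 - s) ζ :=
    mul_nonneg (mul_nonneg (hw_nonneg _ _) (jp_pos _ _).le) (jp_pos _ _).le
  have hj : ∀ x : E3, jp (1 - 2 * s) x = jp (-s) x * jp (1 - s) x := fun x => by
    rw [← jp_add]; congr 1; ring
  rcases le_total ‖ξ‖ ‖η‖ with h | h
  · refine (enorm_le_wt h0 fun hξ => ?_).trans le_self_add
    have h₁ : jp (1 - s) ζ ≤ 2 * jp (1 - s) η :=
      jp_le_two_mul (by linarith) (by linarith) (by linarith)
    calc _ ≤ ‖ξ‖⁻¹ * jp (-s) η * (2 * jp (1 - s) η) := by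
          have := jp_pos (-s) η
          gcongr
          · exact (jp_pos _ _).le
          · exact hw_neg_one_le ξ
      _ = ‖ξ‖⁻¹ * (2 * jp (1 - 2 * s) η) := by rw [hj]; ring
      _ ≤ _ := by
          gcongr
          exact jp_anti (by linarith) h
  · refine (enorm_le_wt h0 fun hη => ?_).trans le_add_self
    have h₁ : jp (1 - s) ζ ≤ 2 * jp (1 - s) ξ :=
      jp_le_two_mul (by linarith) (by linarith) (by linarith)
    calc _ ≤ ‖ξ‖⁻¹ * jp (-s) η * (2 * jp (1 - s) ξ) := by
          have := jp_pos (-s) η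
          gcongr
          · exact (jp_pos _ _).le
          · exact hw_neg_one_le ξ
      _ = 2 * jp (-s) η * (‖ξ‖⁻¹ * jp (1 - s) ξ) := by ring
      _ ≤ 2 * jp (-s) η * (‖η‖⁻¹ * jp (1 - s) η) := by
          have := jp_pos (-s) η
          gcongr 2 * jp (-s) η * ?_
          exact inv_norm_mul_jp_anti (by linarith) hη h
      _ = _ := by rw [hj]; ring

theorem enorm_hw_mul_jp_le (hs : 3 / 4 < s) (hs1 : s ≤ 1) (ξ η : E3) :
    ‖hw (-1) ξ * jp (-s) η‖ₑ ≤ wt s ξ + wt s η := by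
  refine le_trans ?_ (enorm_le_wt_add_wt hs hs1 (ζ := 0) (by simp; positivity))
  have : jp (1 - s) 0 = 1 := by simp [jp]
  rw [this, mul_one]

theorem enorm_jp_mul_jp_le (hs : 3 / 4 < s) (ξ η : E3) :
    ‖jp (-s) ξ * jp (-s) η‖ₑ ≤ wt s ξ + wt s η := by
  wlog h : ‖ξ‖ ≤ ‖η‖ generalizing ξ η
  · rw [mul_comm, add_comm]
    exact this η ξ (le_of_not_ge h)
  refine (enorm_le_wt (mul_nonneg (jp_pos _ _).le (jp_pos _ _).le) fun hξ => ?_).trans le_self_add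
  have hξ' := norm_pos_iff.2 hξ
  have e : jp (1 - 2 * s) ξ = jp 1 ξ * (jp (-s) ξ * jp (-s) ξ) := by
    rw [← jp_add, ← jp_add]; congr 1; ring
  have h₁ : 1 ≤ ‖ξ‖⁻¹ * jp 1 ξ := by
    rw [← div_eq_inv_mul, one_le_div hξ']
    exact norm_le_jp_one ξ
  calc _ ≤ jp (-s) ξ * jp (-s) ξ :=
        mul_le_mul_of_nonneg_left (jp_anti (by linarith) h) (jp_pos _ _).le
    _ ≤ 2 * (‖ξ‖⁻¹ * jp 1 ξ) * (jp (-s) ξ * jp (-s) ξ) :=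
        le_mul_of_one_le_left (mul_pos (jp_pos _ _) (jp_pos _ _)).le (by linarith)
    _ = _ := by rw [e]; ring

/-- The kernel of the product `H^s × H^(s-1) → Ḣ⁻¹`. -/
theorem admissible_prod (hs : 3 / 4 < s) (hs1 : s ≤ 1) :
    AdmissibleKernel (fun ξ η => hw (-1) ξ * jp (-s) η * jp (1 - s) (ξ - η)) (wt s) where
  meas := by simp only [Function.uncurry_def]; fun_prop
  meas_weight := measurable_wt s
  weight_lt := eLpNorm_wt_lt_top hs
  bound ξ η := (enorm_le_wt_add_wt hs hs1 (norm_sub_le ξ η)).trans le_self_add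

/-- The kernel of the product `H^s × Ḣ¹ → L²`. -/
theorem admissible_energy (hs : 3 / 4 < s) (hs1 : s ≤ 1) :
    AdmissibleKernel (fun ξ η => jp (-s) η * hw (-1) (ξ - η)) (wt s) where
  meas := by simp only [Function.uncurry_def]; fun_prop
  meas_weight := measurable_wt s
  weight_lt := eLpNorm_wt_lt_top hs
  bound ξ η := by
    rw [mul_comm, add_assoc, add_comm (wt s η)]
    exact (enorm_hw_mul_jp_le hs hs1 _ _).trans le_add_self

/-- The kernel of the product `H^s × H^s → L²`. -/
theorem admissible_square (hs : 3 / 4 < s) :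
    AdmissibleKernel (fun ξ η => jp (-s) η * jp (-s) (ξ - η)) (wt s) where
  meas := by simp only [Function.uncurry_def]; fun_prop
  meas_weight := measurable_wt s
  weight_lt := eLpNorm_wt_lt_top hs
  bound ξ η := by
    rw [add_assoc]
    exact (enorm_jp_mul_jp_le hs _ _).trans le_add_self

/-- The kernel of the product `H^s × L² → Ḣ⁻¹`. -/
theorem admissible_dual (hs : 3 / 4 < s) (hs1 : s ≤ 1) :
    AdmissibleKernel (fun ξ η => hw (-1) ξ * jp (-s) η) (wt s) where
  meas := by simp only [Function.uncurry_def]; fun_prop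
  meas_weight := measurable_wt s
  weight_lt := eLpNorm_wt_lt_top hs
  bound ξ η := (enorm_hw_mul_jp_le hs hs1 _ _).trans le_self_add

end

/-! ### Operators on `L²` of frequency space -/

theorem memLp_conj_neg (F : L2C) :
    MemLp (fun ξ => (starRingEnd ℂ) (F (-ξ))) 2 (volume : Measure E3) := by
  have h := (Lp.memLp F).comp_measurePreserving (Measure.measurePreserving_neg volume)
  refine h.of_le ?_ (.of_forall fun ξ => ?_)
  · exact Complex.continuous_conj.comp_aestronglyMeasurable h.1
  · simp

/-- The operator `F ↦ conj F(-·)`, to which complex conjugation corresponds under the Fourier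
transform. -/
def conjRefl (F : L2C) : L2C := (memLp_conj_neg F).toLp

theorem coeFn_conjRefl (F : L2C) :
    conjRefl F =ᵐ[volume] fun ξ => (starRingEnd ℂ) (F (-ξ)) := (memLp_conj_neg F).coeFn_toLp

theorem ae_neg {p : E3 → Prop} (h : ∀ᵐ ξ : E3, p ξ) : ∀ᵐ ξ : E3, p (-ξ) :=
  (Measure.measurePreserving_neg (volume : Measure E3)).quasiMeasurePreserving.ae h

theorem norm_conjRefl (F : L2C) : ‖conjRefl F‖ = ‖F‖ := by
  rw [conjRefl, Lp.norm_toLp, Lp.norm_def]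
  congr 1
  rw [← eLpNorm_comp_measurePreserving (Lp.aestronglyMeasurable F)
    (Measure.measurePreserving_neg volume)]
  exact eLpNorm_congr_norm_ae (.of_forall fun ξ => by simp)

theorem conjRefl_sub (F G : L2C) : conjRefl (F - G) = conjRefl F - conjRefl G := by
  refine Lp.ext ?_
  filter_upwards [coeFn_conjRefl (F - G), coeFn_conjRefl F, coeFn_conjRefl G,
    Lp.coeFn_sub (conjRefl F) (conjRefl G), ae_neg (Lp.coeFn_sub F G)] with ξ h₁ h₂ h₃ h₄ h₅
  rw [h₁, h₄, Pi.sub_apply, h₂, h₃, h₅, Pi.sub_apply, map_sub]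

/-- The operator `(F - conj F(-·)) / 2i`, to which taking the imaginary part corresponds under the
Fourier transform. -/
def imPart (F : L2C) : L2C := (1 / (2 * Complex.I) : ℂ) • (F - conjRefl F)

theorem coeFn_imPart (F : L2C) :
    imPart F =ᵐ[volume]
      fun ξ => 1 / (2 * Complex.I) * (F ξ - (starRingEnd ℂ) (F (-ξ))) := by
  filter_upwards [Lp.coeFn_smul (1 / (2 * Complex.I) : ℂ) (F - conjRefl F), coeFn_conjRefl F,
    Lp.coeFn_sub F (conjRefl F)] with ξ h₁ h₂ h₃
  rw [imPart, h₁, Pi.smul_apply, h₃, Pi.sub_apply, h₂, smul_eq_mul]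

theorem norm_imPart_le (F : L2C) : ‖imPart F‖ ≤ ‖F‖ := by
  rw [imPart, norm_smul]
  have h := norm_sub_le F (conjRefl F)
  rw [norm_conjRefl] at h
  have : ‖(1 / (2 * Complex.I) : ℂ)‖ = 1 / 2 := by simp
  rw [this]
  linarith

theorem imPart_sub (F G : L2C) : imPart (F - G) = imPart F - imPart G := by
  rw [imPart, imPart, imPart, ← smul_sub, conjRefl_sub]
  congr 1
  abel

/-- A bounded measurable symbol. -/
structure BoundedSymbol (m : E3 → ℂ) (c : ℝ) : Prop where
  meas : Measurable m
  bound : ∀ ξ, ‖m ξ‖ ≤ c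

theorem BoundedSymbol.memLp {m : E3 → ℂ} {c : ℝ} (hm : BoundedSymbol m c) (F : L2C) :
    MemLp (fun ξ => m ξ * F ξ) 2 volume :=
  (Lp.memLp F).of_le_mul (c := c)
    (hm.meas.aestronglyMeasurable.mul (Lp.aestronglyMeasurable F)) (.of_forall fun ξ => by
      rw [norm_mul]
      gcongr
      exact hm.bound ξ)

/-- Multiplication by a bounded symbol on `L²`. -/
def BoundedSymbol.mul {m : E3 → ℂ} {c : ℝ} (hm : BoundedSymbol m c) (F : L2C) : L2C :=
  (hm.memLp F).toLp

theorem BoundedSymbol.coeFn_mul {m : E3 → ℂ} {c : ℝ} (hm : BoundedSymbol m c) (F : L2C) :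
    hm.mul F =ᵐ[volume] fun ξ => m ξ * F ξ := (hm.memLp F).coeFn_toLp

theorem BoundedSymbol.mul_sub {m : E3 → ℂ} {c : ℝ} (hm : BoundedSymbol m c) (F G : L2C) :
    hm.mul (F - G) = hm.mul F - hm.mul G := by
  refine Lp.ext ?_
  filter_upwards [hm.coeFn_mul (F - G), hm.coeFn_mul F, hm.coeFn_mul G,
    Lp.coeFn_sub (hm.mul F) (hm.mul G), Lp.coeFn_sub F G] with ξ h₁ h₂ h₃ h₄ h₅
  rw [h₁, h₄, Pi.sub_apply, h₂, h₃, h₅, Pi.sub_apply, _root_.mul_sub]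

theorem BoundedSymbol.norm_mul_le {m : E3 → ℂ} {c : ℝ} (hm : BoundedSymbol m c) (F : L2C) :
    ‖hm.mul F‖ ≤ c * ‖F‖ := by
  refine Lp.norm_le_mul_norm_of_ae_le_mul ?_
  filter_upwards [hm.coeFn_mul F] with ξ h
  rw [h, norm_mul]
  gcongr
  exact hm.bound ξ

section
variable {s : ℝ}

/-- Multiplication by `conj φ` from `L²` to `Ḣ⁻¹` is the adjoint of multiplication by `φ` from `Ḣ¹`
to `L²`. -/
theorem inner_dual (hs : 3 / 4 < s) (hs1 : s ≤ 1) (F G Y : L2C) :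
    inner ℂ ((admissible_dual hs hs1).op (conjRefl F) Y) G =
      inner ℂ Y ((admissible_energy hs hs1).op F G) := by
  have hF := L2C.measurable F
  have hG := L2C.measurable G
  have hY := L2C.measurable Y
  -- both inner products are iterated integrals of `H`, in the two orders
  let H : E3 → E3 → ℂ := fun ξ ζ =>
    (starRingEnd ℂ) (Y ξ) * ((jp (-s) (ξ - ζ) * hw (-1) ζ : ℝ) * (F (ξ - ζ) * G ζ))
  have hHm : Measurable (Function.uncurry H) := by
    simp only [H, Function.uncurry_def]
    have : Measurable (starRingEnd ℂ) := Complex.continuous_conj.measurable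
    fun_prop
  have hHi : Integrable (Function.uncurry H) (volume.prod volume) := by
    refine ⟨hHm.aestronglyMeasurable, ?_⟩
    rw [hasFiniteIntegral_iff_enorm, lintegral_prod _ hHm.enorm.aemeasurable]
    have e : ∀ ξ, ∫⁻ ζ, ‖Function.uncurry H (ξ, ζ)‖ₑ = ‖Y ξ‖ₑ *
        ∫⁻ η, ‖((jp (-s) η * hw (-1) (ξ - η) : ℝ) : ℂ) * (F η * G (ξ - η))‖ₑ := by
      intro ξ
      rw [← lintegral_const_mul _ (by fun_prop), ← lintegral_sub_left_eq_self _ ξ]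
      refine lintegral_congr fun ζ => ?_
      simp only [H, Function.uncurry_apply_pair, enorm_mul, sub_sub_cancel]
      congr 1
      simp [enorm_eq_nnnorm]
    simp_rw [e]
    have hm : Measurable fun ξ =>
        ∫⁻ η, ‖((jp (-s) η * hw (-1) (ξ - η) : ℝ) : ℂ) * (F η * G (ξ - η))‖ₑ :=
      ((admissible_energy hs hs1).measurable_integrand F G).enorm.lintegral_prod_right'
    refine (lintegral_mul_le_eLpNorm hY.enorm hm).trans_lt (ENNReal.mul_lt_top ?_ ?_)
    · rw [eLpNorm_enorm]
      exact Lp.eLpNorm_lt_top Y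
    · exact ((admissible_energy hs hs1).eLpNorm_le F G).trans_lt
        (ENNReal.mul_lt_top (ENNReal.mul_lt_top (by norm_num) (eLpNorm_wt_lt_top hs))
          (ENNReal.mul_lt_top enorm_lt_top enorm_lt_top))
  rw [L2.inner_def, L2.inner_def]
  calc _ = ∫ ζ, ∫ ξ, H ξ ζ := by
        refine integral_congr_ae ?_
        filter_upwards [(admissible_dual hs hs1).coeFn_op (conjRefl F) Y] with ζ hζ
        rw [hζ, RCLike.inner_apply, kernelFun, ← integral_conj, ← integral_const_mul,
          ← integral_sub_left_eq_self _ volume ζ]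
        refine integral_congr_ae ?_
        have := (quasiMeasurePreserving_sub_left (volume : Measure E3) ζ).ae_eq_comp
          (coeFn_conjRefl F)
        filter_upwards [this] with ξ hξ
        simp only [Function.comp_apply, neg_sub] at hξ
        simp only [H, hξ, map_mul, Complex.conj_ofReal, Complex.conj_conj, sub_sub_cancel]
        rw [← neg_sub ξ ζ, jp_neg_arg]
        push_cast
        ring
    _ = ∫ ξ, ∫ ζ, H ξ ζ := (integral_integral_swap hHi).symm
    _ = _ := by
        refine integral_congr_ae ?_
        filter_upwards [(admissible_energy hs hs1).coeFn_op F G] with ξ hξ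
        rw [hξ, RCLike.inner_apply, kernelFun, mul_comm, ← integral_const_mul,
          ← integral_sub_left_eq_self _ volume ξ]
        refine integral_congr_ae (.of_forall fun ζ => ?_)
        simp only [H, sub_sub_cancel]

/-- The elliptic operator `-Δ + |φ|²` on the level of `G = |∇| A₀` on the Fourier side, with `|∇|`
divided out. -/
def ellOp (hs : 3 / 4 < s) (hs1 : s ≤ 1) (F G : L2C) : L2C :=
  G + (admissible_dual hs hs1).op (conjRefl F) ((admissible_energy hs hs1).op F G)

theorem ellOp_sub (hs : 3 / 4 < s) (hs1 : s ≤ 1) (F G G' : L2C) :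
    ellOp hs hs1 F (G - G') = ellOp hs hs1 F G - ellOp hs hs1 F G' := by
  simp only [ellOp, map_sub]
  abel

/-- Coercivity: `-Δ + |φ|² ≥ -Δ`. -/
theorem norm_le_norm_ellOp (hs : 3 / 4 < s) (hs1 : s ≤ 1) (F G : L2C) :
    ‖G‖ ≤ ‖ellOp hs hs1 F G‖ := by
  have h : ‖G‖ ^ 2 ≤ ‖ellOp hs hs1 F G‖ * ‖G‖ := by
    calc ‖G‖ ^ 2 ≤ ‖G‖ ^ 2 + ‖(admissible_energy hs hs1).op F G‖ ^ 2 := by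
          linarith [sq_nonneg ‖(admissible_energy hs hs1).op F G‖]
      _ = RCLike.re (inner ℂ (ellOp hs hs1 F G) G) := by
          rw [ellOp, inner_add_left, inner_dual hs hs1, map_add, inner_self_eq_norm_sq,
            inner_self_eq_norm_sq]
      _ ≤ _ := re_inner_le_norm _ _
  rcases eq_or_lt_of_le (norm_nonneg G) with h0 | h0
  · rw [← h0]; exact norm_nonneg _
  · nlinarith

theorem ellOp_injective (hs : 3 / 4 < s) (hs1 : s ≤ 1) (F : L2C) :
    Function.Injective (ellOp hs hs1 F) := by
  intro G G' h
  have := norm_le_norm_ellOp hs hs1 F (G - G')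
  rw [ellOp_sub, h, sub_self, norm_zero] at this
  exact sub_eq_zero.1 (norm_le_zero_iff.1 this)

/-- With `T` the multiplication by `φ` from `Ḣ¹` to `L²`, the elliptic operator is `1 + T* T`, and
the spectrum of `T* T` is nonnegative. -/
theorem ellOp_surjective (hs : 3 / 4 < s) (hs1 : s ≤ 1) (F : L2C) :
    Function.Surjective (ellOp hs hs1 F) := by
  intro N
  let T : L2C →L[ℂ] L2C := (admissible_energy hs hs1).op F
  have hadj : (admissible_dual hs hs1).op (conjRefl F) = star T := by
    rw [ContinuousLinearMap.star_eq_adjoint, ContinuousLinearMap.eq_adjoint_iff]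
    exact fun Y G => inner_dual hs hs1 F G Y
  have hu : IsUnit (1 + star T * T) := by
    by_contra hcon
    have hmem : (-1 : ℝ) ∈ spectrum ℝ (star T * T) := by
      rw [spectrum.mem_iff]
      intro hc
      apply hcon
      have := hc.neg
      simpa [add_comm] using this
    have := spectrum_star_mul_self_nonneg _ hmem
    norm_num at this
  obtain ⟨u, hu⟩ := hu
  refine ⟨(↑u⁻¹ : L2C →L[ℂ] L2C) N, ?_⟩
  have h := congrArg (fun A : L2C →L[ℂ] L2C => A N) u.mul_inv
  rw [hu] at h
  rw [ellOp, hadj]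
  exact h

end

/-! ### Products in physical space and convolutions in frequency space -/

/-- The tempered distribution `V` is the function `v`, its Fourier transform is the function `k`,
and both are regular enough for the product of `v` with an arbitrary `L²` function to make sense
against Schwartz functions on either side of the Fourier transform. -/
structure IsMultiplicand (V : TD) (v k : E3 → ℂ) : Prop where
  fn : IsFunction V v
  ft : HasFourierFunction V k
  meas : Measurable k
  mem : ∀ h : 𝓢(E3, ℂ), MemLp (fun x => h x * v x) 2 volume
  conv : ∀ h : 𝓢(E3, ℂ), eLpNorm (fun ξ => ∫⁻ η, ‖h (ξ + η)‖ₑ * ‖k η‖ₑ) 2 volume < ∞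

theorem continuous_integral_mul {m : E3 → ℂ} (hm : MemLp m 2 volume) :
    Continuous fun u : L2C => ∫ x, m x * u x := by
  let m' : L2C := (hm.star).toLp
  have e : (fun u : L2C => ∫ x, m x * u x) = fun u => inner ℂ m' u := by
    ext u
    rw [L2.inner_def]
    refine integral_congr_ae ?_
    filter_upwards [hm.star.coeFn_toLp] with x hx
    rw [RCLike.inner_apply, hx]
    simp [mul_comm]
  rw [e]
  fun_prop

theorem lintegral_pairing_lt_top {k : E3 → ℂ} (hk : Measurable k) {h : 𝓢(E3, ℂ)}
    (hh : eLpNorm (fun ξ => ∫⁻ η, ‖h (ξ + η)‖ₑ * ‖k η‖ₑ) 2 volume < ∞) (U : L2C) :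
    ∫⁻ ξ, ‖U ξ‖ₑ * ∫⁻ η, ‖h (ξ + η)‖ₑ * ‖k η‖ₑ < ∞ := by
  have hmh : Measurable h := h.continuous.measurable
  have hm : Measurable fun ξ => ∫⁻ η, ‖h (ξ + η)‖ₑ * ‖k η‖ₑ := by
    apply Measurable.lintegral_prod_right' (f := fun p : E3 × E3 => ‖h (p.1 + p.2)‖ₑ * ‖k p.2‖ₑ)
    fun_prop
  refine (lintegral_mul_le_eLpNorm (L2C.measurable U).enorm hm).trans_lt
    (ENNReal.mul_lt_top ?_ hh)
  rw [eLpNorm_enorm]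
  exact Lp.eLpNorm_lt_top U

theorem integrable_pairing {k : E3 → ℂ} (hk : Measurable k) {h : 𝓢(E3, ℂ)}
    (hh : eLpNorm (fun ξ => ∫⁻ η, ‖h (ξ + η)‖ₑ * ‖k η‖ₑ) 2 volume < ∞) (U : L2C) :
    Integrable (fun p : E3 × E3 => U p.1 * (h (p.1 + p.2) * k p.2)) (volume.prod volume) := by
  have hmh : Measurable h := h.continuous.measurable
  have hU := L2C.measurable U
  refine ⟨by fun_prop, ?_⟩
  rw [hasFiniteIntegral_iff_enorm, lintegral_prod _ (by fun_prop)]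
  simp only [enorm_mul]
  refine lt_of_eq_of_lt (lintegral_congr fun ξ => ?_) (lintegral_pairing_lt_top hk hh U)
  exact lintegral_const_mul _ (by fun_prop)

theorem integrable_pairing_conv {k : E3 → ℂ} (hk : Measurable k) {h : 𝓢(E3, ℂ)}
    (hh : eLpNorm (fun ξ => ∫⁻ η, ‖h (ξ + η)‖ₑ * ‖k η‖ₑ) 2 volume < ∞) (U : L2C) :
    Integrable (fun p : E3 × E3 => h p.1 * (U p.2 * k (p.1 - p.2))) (volume.prod volume) := by
  have hmh : Measurable h := h.continuous.measurable
  have hU := L2C.measurable U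
  refine ⟨by fun_prop, ?_⟩
  rw [hasFiniteIntegral_iff_enorm, lintegral_prod_symm _ (by fun_prop)]
  simp only [enorm_mul]
  refine lt_of_eq_of_lt (lintegral_congr fun η => ?_) (lintegral_pairing_lt_top hk hh U)
  rw [← lintegral_const_mul _ (by fun_prop), ← lintegral_add_right_eq_self _ η]
  refine lintegral_congr fun ξ => ?_
  rw [add_sub_cancel_right, add_comm η ξ]
  ring

theorem integrable_mul_cv {k : E3 → ℂ} (hk : Measurable k) {h : 𝓢(E3, ℂ)}
    (hh : eLpNorm (fun ξ => ∫⁻ η, ‖h (ξ + η)‖ₑ * ‖k η‖ₑ) 2 volume < ∞) (U : L2C) :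
    Integrable (fun ξ => h ξ * cv U k ξ) volume := by
  have := (integrable_pairing_conv hk hh U).integral_prod_left
  simpa only [integral_const_mul, ← cv.eq_1] using this

theorem integral_mul_cv {k : E3 → ℂ} (hk : Measurable k) {h : 𝓢(E3, ℂ)}
    (hh : eLpNorm (fun ξ => ∫⁻ η, ‖h (ξ + η)‖ₑ * ‖k η‖ₑ) 2 volume < ∞) (U : L2C) :
    ∫ ξ, h ξ * cv U k ξ = ∫ η, (∫ ξ, h (η + ξ) * k ξ) * U η := by
  calc _ = ∫ ξ, ∫ η, h ξ * (U η * k (ξ - η)) := by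
        simp only [cv, integral_const_mul]
    _ = ∫ η, ∫ ξ, h ξ * (U η * k (ξ - η)) :=
        integral_integral_swap (integrable_pairing_conv hk hh U)
    _ = _ := by
        refine integral_congr_ae (.of_forall fun η => ?_)
        simp only
        rw [← integral_mul_const, ← integral_add_right_eq_self _ η]
        refine integral_congr_ae (.of_forall fun ξ => ?_)
        simp only
        rw [add_sub_cancel_right, add_comm η ξ]
        ring

theorem memLp_pairing {k : E3 → ℂ} (hk : Measurable k) {h : 𝓢(E3, ℂ)}
    (hh : eLpNorm (fun ξ => ∫⁻ η, ‖h (ξ + η)‖ₑ * ‖k η‖ₑ) 2 volume < ∞) :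
    MemLp (fun η => ∫ ξ, h (η + ξ) * k ξ) 2 volume := by
  have hmh : Measurable h := h.continuous.measurable
  refine ⟨?_, lt_of_le_of_lt (eLpNorm_mono_enorm fun ξ => ?_) hh⟩
  · have : Measurable fun p : E3 × E3 => h (p.1 + p.2) * k p.2 := by fun_prop
    exact (this.stronglyMeasurable.integral_prod_right').aestronglyMeasurable
  · simp only [← enorm_mul, enorm_eq_self]
    exact enorm_integral_le_lintegral_enorm _

/-- The case `u = ψ` of `IsMultiplicand.integral_fourier_mul`: here `ψ 𝓕 h` is the Fourier transform
of a Schwartz function, a convolution, against which `V` can be tested. -/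
theorem IsMultiplicand.integral_schwartz {V : TD} {v k : E3 → ℂ} (hV : IsMultiplicand V v k)
    (ψ h : 𝓢(E3, ℂ)) :
    ∫ x, ((𝓕 h) x * v x) * ψ x = ∫ η, (∫ ξ, h (η + ξ) * k ξ) * (𝓕 ψ) η := by
  let B := ContinuousLinearMap.mul ℂ ℂ
  let g : 𝓢(E3, ℂ) := SchwartzMap.convolution B (𝓕⁻ ψ) h
  have hg : ∀ x, g x = ∫ η, (𝓕 ψ) η * h (η + x) := by
    intro x
    simp only [g]
    rw [SchwartzMap.convolution_apply, convolution_def, ← integral_neg_eq_self]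
    refine integral_congr_ae (.of_forall fun η => ?_)
    simp only [B, ContinuousLinearMap.mul_apply', sub_neg_eq_add]
    rw [add_comm x η, SchwartzMap.fourierInv_coe, SchwartzMap.fourier_coe,
      Real.fourierInv_eq_fourier_neg, neg_neg]
  have hFg : ∀ x, (𝓕 g) x = ψ x * (𝓕 h) x := by
    intro x
    simp only [g]
    rw [SchwartzMap.fourier_convolution]
    simp [B]
  have h₁ := (hV.fn.2 (𝓕 g)).2
  have h₂ := (hV.ft.2 g).2
  rw [TemperedDistribution.fourier_apply, h₁] at h₂
  calc _ = ∫ x, (𝓕 g) x * v x := by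
        refine integral_congr_ae (.of_forall fun x => ?_)
        simp only [hFg]
        ring
    _ = ∫ ξ, g ξ * k ξ := h₂
    _ = ∫ ξ, ∫ η, (𝓕 ψ) η * (h (η + ξ) * k ξ) := by
        refine integral_congr_ae (.of_forall fun ξ => ?_)
        simp only [hg]
        rw [← integral_mul_const]
        simp only [mul_assoc]
    _ = ∫ η, ∫ ξ, (𝓕 ψ) η * (h (η + ξ) * k ξ) := by
        refine (integral_integral_swap ?_).symm
        refine (integrable_pairing hV.meas (hV.conv h) ((𝓕 ψ).toLp 2)).congr ?_
        have := Measure.quasiMeasurePreserving_fst (μ := (volume : Measure E3))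
          (ν := (volume : Measure E3)) |>.ae_eq_comp ((𝓕 ψ).coeFn_toLp 2 volume)
        filter_upwards [this] with p hp
        simp only [Function.comp_apply] at hp
        rw [hp, Function.uncurry_def]
    _ = _ := by
        refine integral_congr_ae (.of_forall fun η => ?_)
        simp only
        rw [integral_const_mul, mul_comm]

/-- The Fourier transform takes the product of an `L²` function `u` with a function `v` to the
convolution of the Fourier transforms, tested against Schwartz functions. Both sides are continuous
in `u ∈ L²`, so that it suffices to treat Schwartz functions `u`. -/
theorem IsMultiplicand.integral_fourier_mul {V : TD} {v k : E3 → ℂ} (hV : IsMultiplicand V v k)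
    (u : L2C) (h : 𝓢(E3, ℂ)) :
    ∫ x, (𝓕 h) x * (u x * v x) = ∫ ξ, h ξ * cv (𝓕 u : L2C) k ξ := by
  rw [integral_mul_cv hV.meas (hV.conv h)]
  have e : ∀ u : L2C, ∫ x, (𝓕 h) x * (u x * v x) = ∫ x, ((𝓕 h) x * v x) * u x := fun u => by
    congr 1; ext x; ring
  rw [e]
  refine DenseRange.induction_on
    (p := fun u : L2C => ∫ x, ((𝓕 h) x * v x) * u x =
      ∫ η, (∫ ξ, h (η + ξ) * k ξ) * (𝓕 u : L2C) η)
    (SchwartzMap.denseRange_toLpCLM (p := 2) ENNReal.ofNat_ne_top) u ?_ fun ψ => ?_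
  · exact isClosed_eq (continuous_integral_mul (hV.mem (𝓕 h)))
      ((continuous_integral_mul (memLp_pairing hV.meas (hV.conv h))).comp
        (Lp.fourierTransformₗᵢ E3 ℂ).continuous)
  · rw [SchwartzMap.toLpCLM_apply, SchwartzMap.toLp_fourier_eq]
    calc _ = ∫ x, ((𝓕 h) x * v x) * ψ x := by
          refine integral_congr_ae ?_
          filter_upwards [ψ.coeFn_toLp 2 volume] with x hx
          rw [hx]
      _ = _ := hV.integral_schwartz ψ h
      _ = _ := by
          refine integral_congr_ae ?_
          filter_upwards [(𝓕 ψ).coeFn_toLp 2 volume] with x hx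
          rw [hx]

theorem IsMultiplicand.hasFourierFunction {V T : TD} {v k : E3 → ℂ} (hV : IsMultiplicand V v k)
    (u : L2C) (hT : IsFunction T (fun x => u x * v x)) :
    HasFourierFunction T (cv (𝓕 u : L2C) k) := by
  refine isFunction_of_forall fun h => ⟨integrable_mul_cv hV.meas (hV.conv h) _, ?_⟩
  rw [TemperedDistribution.fourier_apply, (hT.2 (𝓕 h)).2]
  exact hV.integral_fourier_mul u h

/-- If the convolution of the Fourier transforms is square integrable, then so is the product. -/
theorem IsMultiplicand.ae_eq_fourierInv {V : TD} {v k : E3 → ℂ} (hV : IsMultiplicand V v k)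
    (u Q : L2C) (hQ : cv (𝓕 u : L2C) k =ᵐ[volume] Q) :
    (fun x => u x * v x) =ᵐ[volume] (𝓕⁻ Q : L2C) := by
  refine IsFunction.ae_eq (T := ((𝓕⁻ Q : L2C) : TD)) (isFunction_of_forall fun g => ⟨?_, ?_⟩)
    (isFunction_Lp _)
  · have := (hV.mem g).integrable_mul (Lp.memLp u)
    refine this.congr (.of_forall fun x => ?_)
    simp only [Pi.mul_apply]
    ring
  · have h₁ := ((hasFourierFunction_fourierInv_L2 Q).2 (𝓕⁻ g)).2
    have h₂ := hV.integral_fourier_mul u (𝓕⁻ g)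
    rw [TemperedDistribution.fourier_apply] at h₁
    rw [FourierTransform.fourier_fourierInv_eq] at h₁ h₂
    rw [h₁, h₂]
    refine integral_congr_ae ?_
    filter_upwards [hQ] with ξ hξ
    rw [hξ]

theorem IsMultiplicand.congr {V : TD} {v k k' : E3 → ℂ} (hV : IsMultiplicand V v k)
    (hk' : Measurable k') (h : k =ᵐ[volume] k') : IsMultiplicand V v k' where
  fn := hV.fn
  ft := hV.ft.congr h
  meas := hk'
  mem := hV.mem
  conv g := by
    have e : (fun ξ => ∫⁻ η, ‖g (ξ + η)‖ₑ * ‖k' η‖ₑ) =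
        fun ξ => ∫⁻ η, ‖g (ξ + η)‖ₑ * ‖k η‖ₑ := by
      ext ξ
      refine lintegral_congr_ae ?_
      filter_upwards [h] with η hη
      rw [hη]
    rw [e]
    exact hV.conv g

theorem IsMultiplicand.add {V V' : TD} {v v' k k' : E3 → ℂ} (hV : IsMultiplicand V v k)
    (hV' : IsMultiplicand V' v' k') :
    IsMultiplicand (V + V') (fun x => v x + v' x) (fun ξ => k ξ + k' ξ) where
  fn := hV.fn.add hV'.fn
  ft := hV.ft.add hV'.ft
  meas := hV.meas.add hV'.meas
  mem h := by
    refine ((hV.mem h).add (hV'.mem h)).ae_eq (.of_forall fun x => ?_)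
    simp only [Pi.add_apply]
    ring
  conv h := by
    have hmh : Measurable h := h.continuous.measurable
    have m : ∀ {k : E3 → ℂ}, Measurable k →
        Measurable fun ξ => ∫⁻ η, ‖h (ξ + η)‖ₑ * ‖k η‖ₑ := fun {k} hk => by
      apply Measurable.lintegral_prod_right' (f := fun p : E3 × E3 => ‖h (p.1 + p.2)‖ₑ * ‖k p.2‖ₑ)
      fun_prop
    have hm := hV.meas
    refine lt_of_le_of_lt (eLpNorm_mono_enorm (g := (fun ξ => ∫⁻ η, ‖h (ξ + η)‖ₑ * ‖k η‖ₑ) +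
      fun ξ => ∫⁻ η, ‖h (ξ + η)‖ₑ * ‖k' η‖ₑ) fun ξ => ?_)
      ((eLpNorm_add_le (m hV.meas).aestronglyMeasurable (m hV'.meas).aestronglyMeasurable
        (by norm_num)).trans_lt (ENNReal.add_lt_top.2 ⟨hV.conv h, hV'.conv h⟩))
    simp only [enorm_eq_self, Pi.add_apply]
    rw [← lintegral_add_left (by fun_prop)]
    refine lintegral_mono fun η => ?_
    rw [← mul_add]
    gcongr
    exact enorm_add_le _ _

theorem conv_eq_lintegral_convolution (h : 𝓢(E3, ℂ)) (k : E3 → ℂ) (ξ : E3) :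
    ∫⁻ η, ‖h (ξ + η)‖ₑ * ‖k η‖ₑ = ∫⁻ η, ‖k (-η)‖ₑ * ‖h (ξ - η)‖ₑ := by
  rw [← lintegral_neg_eq_self]
  refine lintegral_congr fun η => ?_
  rw [← sub_eq_add_neg, mul_comm]

theorem isMultiplicand_L2 (u : L2C) : IsMultiplicand (u : TD) u (𝓕 u : L2C) where
  fn := isFunction_Lp u
  ft := hasFourierFunction_L2 u
  meas := L2C.measurable _
  mem h := (Lp.memLp u).of_le_mul (c := SchwartzMap.seminorm ℝ 0 0 h)
    (h.continuous.aestronglyMeasurable.mul (Lp.aestronglyMeasurable u)) (.of_forall fun x => by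
      rw [norm_mul]
      gcongr
      exact h.norm_le_seminorm ℝ x)
  conv h := by
    have hmh : Measurable h := h.continuous.measurable
    have hu := L2C.measurable (𝓕 u : L2C)
    simp_rw [conv_eq_lintegral_convolution]
    refine (eLpNorm_convolution_le_right (F := fun η => ‖(𝓕 u : L2C) (-η)‖ₑ)
      (G := fun η => ‖h η‖ₑ) (by fun_prop) (by fun_prop)).trans_lt (ENNReal.mul_lt_top ?_ ?_)
    · rw [eLpNorm_enorm (fun η => (𝓕 u : L2C) (-η))]
      exact ((Lp.memLp _).comp_measurePreserving (Measure.measurePreserving_neg volume)).2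
    · exact h.integrable.2

theorem fourierInv_integrable_bound (k : E3 → ℂ) (x : E3) :
    ‖𝓕⁻ k x‖ ≤ ∫ ξ, ‖k ξ‖ := by
  rw [Real.fourierInv_eq]
  refine (norm_integral_le_integral_norm _).trans (le_of_eq ?_)
  simp

theorem isMultiplicand_integrable {k : E3 → ℂ} (hk : Measurable k) (hki : Integrable k volume) :
    ∃ V : TD, IsMultiplicand V (𝓕⁻ k) k := by
  obtain ⟨T, hT⟩ := exists_isFunction_of_memLp (memLp_one_iff_integrable.2 hki)
  have hc : Continuous (𝓕⁻ k) := by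
    have : 𝓕⁻ k = fun x => 𝓕 k (-x) := by ext x; rw [Real.fourierInv_eq_fourier_neg]
    rw [this]
    exact (VectorFourier.fourierIntegral_continuous Real.continuous_fourierChar
      (by exact continuous_inner) hki).comp continuous_neg
  refine ⟨𝓕⁻ T, ?_, hT.fourierInv, hk, fun h => ?_, fun h => ?_⟩
  · refine isFunction_of_forall fun h => ⟨?_, ?_⟩
    · refine (h.integrable (μ := (volume : Measure E3))).mul_bdd
        (c := ∫ ξ, ‖k ξ‖) hc.aestronglyMeasurable ?_
      exact .of_forall (fourierInv_integrable_bound k)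
    · rw [TemperedDistribution.fourierInv_apply, (hT.2 _).2]
      have h₁ := VectorFourier.integral_fourierIntegral_smul_eq_flip (L := innerₗ E3)
        (f := fun x => h (-x)) (g := k) Real.continuous_fourierChar (by exact continuous_inner)
        (h.integrable (μ := (volume : Measure E3))).comp_neg hki
      rw [flip_innerₗ] at h₁
      simp only [smul_eq_mul] at h₁
      calc _ = ∫ ξ, VectorFourier.fourierIntegral Real.fourierChar volume (innerₗ E3)
            (fun x => h (-x)) ξ * k ξ := by
            refine integral_congr_ae (.of_forall fun ξ => ?_)
            simp only
            congr 1
            rw [SchwartzMap.fourierInv_coe, Real.fourierInv_eq_fourier_comp_neg]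
            rfl
        _ = _ := h₁
        _ = _ := by
            rw [← integral_neg_eq_self]
            refine integral_congr_ae (.of_forall fun x => ?_)
            simp only [neg_neg]
            rw [Real.fourierInv_eq_fourier_neg]
            rfl
  · refine (h.memLp 2 volume).of_le_mul (c := ∫ ξ, ‖k ξ‖)
      (h.continuous.aestronglyMeasurable.mul hc.aestronglyMeasurable) (.of_forall fun x => ?_)
    rw [norm_mul, mul_comm]
    gcongr
    exact fourierInv_integrable_bound k x
  · have hmh : Measurable h := h.continuous.measurable
    simp_rw [conv_eq_lintegral_convolution]
    refine (eLpNorm_convolution_le_left (F := fun η => ‖k (-η)‖ₑ)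
      (G := fun η => ‖h η‖ₑ) (by fun_prop) (by fun_prop)).trans_lt (ENNReal.mul_lt_top ?_ ?_)
    · exact hki.comp_neg.2
    · rw [eLpNorm_enorm]
      exact (h.memLp 2 volume).2

/-! ### Weighted `L²` spaces of Fourier transforms -/

/-- The Fourier transform of `u` is the function `m F` with `F ∈ L²`. For `m = ⟨ξ⟩^(-σ)` this says
that `u ∈ H^σ`, for `m = (2π|ξ|)^(-σ)` that `u` is in the homogeneous space of order `σ`; in both
cases the norm of `u` is that of `F`. -/
def HasWeight (m : E3 → ℝ) (u : TD) (F : L2C) : Prop :=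
  HasFourierFunction u (fun ξ => (m ξ : ℂ) * F ξ)

section
variable {m : E3 → ℝ} {u v : TD} {F G : L2C}

theorem L2C.eq_of_mul_ae_eq (hm : ∀ᵐ ξ, m ξ ≠ 0)
    (h : (fun ξ => (m ξ : ℂ) * F ξ) =ᵐ[volume] fun ξ => (m ξ : ℂ) * G ξ) : F = G := by
  refine Lp.ext ?_
  filter_upwards [hm, h] with ξ h₁ h₂
  exact mul_left_cancel₀ (Complex.ofReal_ne_zero.2 h₁) h₂

theorem HasWeight.unique (hm : ∀ᵐ ξ, m ξ ≠ 0) (hF : HasWeight m u F) (hG : HasWeight m u G) :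
    F = G :=
  L2C.eq_of_mul_ae_eq hm (HasFourierFunction.ae_eq hF hG)

theorem HasWeight.inj (hF : HasWeight m u F) (hG : HasWeight m v F) : u = v :=
  HasFourierFunction.ext hF hG .rfl

theorem HasWeight.add (hF : HasWeight m u F) (hG : HasWeight m v G) :
    HasWeight m (u + v) (F + G) := by
  refine (HasFourierFunction.add hF hG).congr ?_
  filter_upwards [Lp.coeFn_add F G] with ξ h
  rw [h, Pi.add_apply, mul_add]

theorem HasWeight.sub (hF : HasWeight m u F) (hG : HasWeight m v G) :
    HasWeight m (u - v) (F - G) := by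
  refine (HasFourierFunction.sub hF hG).congr ?_
  filter_upwards [Lp.coeFn_sub F G] with ξ h
  rw [h, Pi.sub_apply, _root_.mul_sub]

theorem HasWeight.neg (hF : HasWeight m u F) : HasWeight m (-u) (-F) := by
  refine (HasFourierFunction.neg hF).congr ?_
  filter_upwards [Lp.coeFn_neg F] with ξ h
  rw [h, Pi.neg_apply, mul_neg]

theorem HasWeight.conj (hm : ∀ ξ, m (-ξ) = m ξ) (hF : HasWeight m u F) :
    HasWeight m (conjTD u) (conjRefl F) := by
  refine (HasFourierFunction.conj hF).congr ?_
  filter_upwards [coeFn_conjRefl F] with ξ h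
  rw [h, map_mul, Complex.conj_ofReal, hm]

theorem HasWeight.im (hm : ∀ ξ, m (-ξ) = m ξ) (hF : HasWeight m u F) :
    HasWeight m (imTD u) (imPart F) := by
  refine (HasFourierFunction.im hF).congr ?_
  filter_upwards [coeFn_imPart F] with ξ h
  rw [h, map_mul, Complex.conj_ofReal, hm]
  ring

end

theorem hw_ne_zero (σ : ℝ) : ∀ᵐ ξ, hw σ ξ ≠ 0 := by
  filter_upwards [ae_ne_zero] with ξ hξ
  exact (hw_pos σ hξ).ne'

theorem abs_apply_le_norm (ξ : E3) (k : Fin 3) : |ξ k| ≤ ‖ξ‖ := by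
  simpa using PiLp.norm_apply_le ξ k

theorem norm_mul_jp_le_one (ξ : E3) : ‖ξ‖ * jp (-1) ξ ≤ 1 :=
  calc ‖ξ‖ * jp (-1) ξ ≤ jp 1 ξ * jp (-1) ξ :=
        mul_le_mul_of_nonneg_right (norm_le_jp_one ξ) (jp_pos _ _).le
    _ = 1 := by rw [mul_comm, jp_neg_mul]

/-- The symbol of `∂_k ⟨∇⟩⁻¹`. -/
theorem boundedSymbol_deriv (k : Fin 3) :
    BoundedSymbol (fun ξ : E3 => 2 * Real.pi * Complex.I * (ξ k : ℂ) * (jp (-1) ξ : ℂ))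
      (2 * Real.pi) where
  meas := by fun_prop
  bound ξ := by
    have h₁ : |ξ k| * jp (-1) ξ ≤ 1 :=
      (mul_le_mul_of_nonneg_right (abs_apply_le_norm ξ k) (jp_pos _ _).le).trans
        (norm_mul_jp_le_one ξ)
    simp only [norm_mul, Complex.norm_ofNat, Complex.norm_real, Complex.norm_I,
      Real.norm_eq_abs, abs_of_pos Real.pi_pos, abs_of_pos (jp_pos (-1) ξ), mul_assoc]
    nlinarith [Real.pi_pos]

/-- On the Fourier side, `∂_k` maps `H^s` to `H^(s-1)` by multiplication with a bounded symbol. -/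
theorem HasWeight.deriv {s : ℝ} {u : TD} {F : L2C} (hF : HasWeight (jp (-s)) u F) (k : Fin 3) :
    HasWeight (jp (1 - s)) (∂_{basisVec k} u) ((boundedSymbol_deriv k).mul F) := by
  refine (HasFourierFunction.deriv hF k).congr ?_
  filter_upwards [(boundedSymbol_deriv k).coeFn_mul F] with ξ h
  have e : jp (-s) ξ = jp (1 - s) ξ * jp (-1) ξ := by rw [← jp_add]; congr 1; ring
  rw [h, e]
  push_cast
  ring

theorem exists_hasWeight_of_memSobolev {σ : ℝ} {u : TD} (hu : MemSobolev σ 2 u) :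
    ∃ F, HasWeight (jp (-σ)) u F := by
  obtain ⟨f, hf⟩ := hu
  rw [← besselPotential_neg_apply_eq_iff] at hf
  refine ⟨𝓕 f, ?_⟩
  rw [← hf]
  exact (hasFourierFunction_L2 f).multiplier (hasTemperateGrowth_jp (-σ))

theorem enorm_fourierInv (F : L2C) : ‖(𝓕⁻ F : L2C)‖ₑ = ‖F‖ₑ := by
  have := Lp.norm_fourier_eq (𝓕⁻ F : L2C)
  rw [FourierTransform.fourier_fourierInv_eq] at this
  rw [← ofReal_norm, ← ofReal_norm, this]

theorem HasWeight.sobNorm_eq {σ : ℝ} {u : TD} {F : L2C} (hF : HasWeight (jp (-σ)) u F) :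
    sobNorm σ u = ‖F‖ₑ := by
  have h₁ : besselPotential E3 ℂ σ u = ((𝓕⁻ F : L2C) : TD) := by
    refine HasFourierFunction.ext
      (HasFourierFunction.multiplier hF (hasTemperateGrowth_jp σ))
      (hasFourierFunction_fourierInv_L2 F) (.of_forall fun ξ => ?_)
    change (jp σ ξ : ℂ) * ((jp (-σ) ξ : ℂ) * F ξ) = F ξ
    rw [← mul_assoc, ← Complex.ofReal_mul, mul_comm (jp σ ξ), jp_neg_mul]
    simp
  unfold sobNorm
  refine le_antisymm ?_ ?_
  · exact (iInf₂_le (𝓕⁻ F : L2C) h₁).trans_eq (enorm_fourierInv F)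
  · refine le_iInf₂ fun f hf => ?_
    have : (𝓕⁻ F : L2C) = f :=
      Lp.ext (IsFunction.ae_eq (isFunction_Lp _) (h₁ ▸ hf ▸ isFunction_Lp f))
    rw [← this, enorm_fourierInv]

theorem HasWeight.homNorm_eq {σ : ℝ} {u : TD} {G : L2C} (hG : HasWeight (hw (-σ)) u G) :
    homNorm σ u = ‖G‖ₑ := by
  have e : ∀ f : E3 → ℂ, HasFourierFunction u f →
      eLpNorm (fun ξ => (((2 * Real.pi * ‖ξ‖) ^ σ : ℝ) : ℂ) * f ξ) 2 volume = ‖G‖ₑ := by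
    intro f hf
    rw [Lp.enorm_def]
    refine eLpNorm_congr_ae ?_
    filter_upwards [hf.ae_eq hG, ae_ne_zero] with ξ h₁ h₂
    have := hw_mul_hw_neg σ h₂
    rw [hw] at this
    rw [h₁, ← mul_assoc, ← Complex.ofReal_mul, this]
    simp
  unfold homNorm
  refine le_antisymm ?_ ?_
  · exact iInf_le_of_le _ (iInf_le_of_le hG (e _ hG).le)
  · exact le_iInf₂ fun f hf => (e f hf).ge

theorem exists_hasWeight_of_homNorm_lt {σ : ℝ} {u : TD} (hu : homNorm σ u < ∞) :
    ∃ G, HasWeight (hw (-σ)) u G := by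
  obtain ⟨f, hf, hlt⟩ := by simpa only [homNorm, iInf_lt_iff] using hu
  have hm : AEStronglyMeasurable
      (fun ξ : E3 => (((2 * Real.pi * ‖ξ‖) ^ σ : ℝ) : ℂ) * f ξ) volume := by
    refine AEStronglyMeasurable.mul ?_ hf.1.aestronglyMeasurable
    exact (by fun_prop : Measurable fun ξ : E3 => (((2 * Real.pi * ‖ξ‖) ^ σ : ℝ) : ℂ))
      |>.aestronglyMeasurable
  have hmem : MemLp (fun ξ : E3 => (((2 * Real.pi * ‖ξ‖) ^ σ : ℝ) : ℂ) * f ξ) 2 volume :=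
    ⟨hm, hlt⟩
  refine ⟨hmem.toLp, hf.congr ?_⟩
  filter_upwards [hmem.coeFn_toLp, ae_ne_zero] with ξ h₁ h₂
  have := hw_mul_hw_neg σ h₂
  rw [hw, mul_comm] at this
  rw [h₁, ← mul_assoc, ← Complex.ofReal_mul, this]
  simp

theorem boundedSymbol_norm_div :
    BoundedSymbol (fun ξ : E3 => ((hw 1 ξ * jp (-1) ξ : ℝ) : ℂ)) (2 * Real.pi) where
  meas := by fun_prop
  bound ξ := by
    have h₁ := norm_mul_jp_le_one ξ
    rw [Complex.norm_real, Real.norm_eq_abs, abs_of_nonneg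
      (mul_nonneg (hw_nonneg _ _) (jp_pos _ _).le), hw_one, mul_assoc]
    nlinarith [Real.pi_pos]

/-- Every `N ∈ L²` is the weighted Fourier transform of an element of `Ḣ⁻¹`. -/
theorem exists_hasWeight_hw_one (N : L2C) : ∃ u, HasWeight (hw 1) u N := by
  -- `hw 1` is not smooth at the origin, hence the detour through `⟨ξ⟩ (hw 1 ⟨ξ⟩⁻¹ N)`
  have h := IsFunction.smulLeft (isFunction_Lp (boundedSymbol_norm_div.mul N))
    (hasTemperateGrowth_jp 1)
  refine ⟨_, h.fourierInv.congr ?_⟩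
  filter_upwards [boundedSymbol_norm_div.coeFn_mul N] with ξ hξ
  have : jp 1 ξ * (hw 1 ξ * jp (-1) ξ) = hw 1 ξ := by
    linear_combination hw 1 ξ * jp_neg_mul 1 ξ
  rw [hξ, ← mul_assoc, ← Complex.ofReal_mul, this]

theorem hw_neg_one_le_wt {ξ : E3} (hξ : ‖ξ‖ ≤ 1) : ‖hw (-1) ξ‖ₑ ≤ wt 1 ξ := by
  refine enorm_le_wt (hw_nonneg _ _) fun h0 => (hw_neg_one_le ξ).trans ?_
  refine le_mul_of_one_le_right (by positivity) ?_
  have e : 1 - 2 * (1 : ℝ) = -1 := by norm_num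
  have h₁ : jp 1 ξ ≤ 2 := by
    unfold jp
    rw [← Real.sqrt_eq_rpow, Real.sqrt_le_left (by norm_num)]
    nlinarith [norm_nonneg ξ]
  have h₂ := jp_neg_mul 1 ξ
  have h₃ := jp_pos (-1) ξ
  rw [e]
  nlinarith

/-- An element of `Ḣ¹` is a function: the low frequencies of its Fourier transform are integrable,
the high ones square integrable. -/
theorem exists_isMultiplicand_hw (G : L2C) :
    ∃ (V : TD) (a : E3 → ℂ), IsMultiplicand V a (fun ξ => (hw (-1) ξ : ℂ) * G ξ) := by
  have hG := L2C.measurable G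
  let k : E3 → ℂ := fun ξ => (hw (-1) ξ : ℂ) * G ξ
  have hk : Measurable k := by fun_prop
  let S : Set E3 := Metric.closedBall 0 1
  have hS : MeasurableSet S := Metric.isClosed_closedBall.measurableSet
  have h₁ : Integrable (S.indicator k) volume := by
    refine ⟨(hk.indicator hS).aestronglyMeasurable, ?_⟩
    rw [hasFiniteIntegral_iff_enorm]
    refine lt_of_le_of_lt (lintegral_mono (g := fun ξ => wt 1 ξ * ‖G ξ‖ₑ) fun ξ => ?_)
      ((lintegral_mul_le_eLpNorm (measurable_wt 1) hG.enorm).trans_lt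
        (ENNReal.mul_lt_top (eLpNorm_wt_lt_top (by norm_num)) ?_))
    · by_cases hξ : ξ ∈ S
      · rw [Set.indicator_of_mem hξ, enorm_mul]
        have := hw_neg_one_le_wt (ξ := ξ) (by simpa [S] using hξ)
        exact mul_le_mul' (by simpa [enorm_eq_nnnorm] using this) le_rfl
      · simp [Set.indicator_of_notMem hξ]
    · rw [eLpNorm_enorm]
      exact Lp.eLpNorm_lt_top G
  have h₂ : MemLp (Sᶜ.indicator k) 2 volume := by
    refine (Lp.memLp G).of_le (hk.indicator hS.compl).aestronglyMeasurable (.of_forall fun ξ => ?_)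
    by_cases hξ : ξ ∈ Sᶜ
    · rw [Set.indicator_of_mem hξ, norm_mul, Complex.norm_real, Real.norm_eq_abs,
        abs_of_nonneg (hw_nonneg _ _)]
      refine mul_le_of_le_one_left (norm_nonneg _) ((hw_neg_one_le ξ).trans ?_)
      have : 1 < ‖ξ‖ := by simpa [S] using hξ
      exact inv_le_one_of_one_le₀ this.le
    · rw [Set.indicator_of_notMem hξ]
      simp
  obtain ⟨V₁, hV₁⟩ := isMultiplicand_integrable (hk.indicator hS) h₁
  have hV₂ := isMultiplicand_L2 (𝓕⁻ h₂.toLp : L2C)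
  rw [FourierTransform.fourier_fourierInv_eq] at hV₂
  refine ⟨_, _, (hV₁.add hV₂).congr hk ?_⟩
  filter_upwards [h₂.coeFn_toLp] with ξ hξ
  rw [hξ]
  exact congrFun (Set.indicator_self_add_compl S k) ξ

theorem HasWeight.exists_isMultiplicand {u : TD} {G : L2C} (hG : HasWeight (hw (-1)) u G) :
    ∃ a : E3 → ℂ, IsMultiplicand u a (fun ξ => (hw (-1) ξ : ℂ) * G ξ) := by
  obtain ⟨V, a, hV⟩ := exists_isMultiplicand_hw G
  have : V = u := HasFourierFunction.ext hV.ft hG .rfl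
  exact ⟨a, this ▸ hV⟩

theorem kernelFun_eq (a b c : E3 → ℝ) (F G : E3 → ℂ) (ξ : E3) :
    kernelFun (fun ξ η => a ξ * b η * c (ξ - η)) F G ξ =
      (a ξ : ℂ) * cv (fun η => (b η : ℂ) * F η) (fun η => (c η : ℂ) * G η) ξ := by
  rw [kernelFun, cv, ← integral_const_mul]
  congr 1
  ext η
  push_cast
  ring

section
variable {s : ℝ} (hs : 3 / 4 < s) (hs1 : s ≤ 1)

theorem cv_prod_ae_eq (F Φ : L2C) :
    cv (fun η => (jp (-s) η : ℂ) * F η) (fun η => (jp (1 - s) η : ℂ) * Φ η) =ᵐ[volume]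
      fun ξ => (hw 1 ξ : ℂ) * (admissible_prod hs hs1).op F Φ ξ := by
  filter_upwards [(admissible_prod hs hs1).coeFn_op F Φ, ae_ne_zero] with ξ h₁ h₂
  rw [h₁, kernelFun_eq, ← mul_assoc, ← Complex.ofReal_mul, hw_mul_hw_neg 1 h₂]
  simp

theorem cv_dual_ae_eq (F Y : L2C) :
    cv (fun η => (jp (-s) η : ℂ) * F η) Y =ᵐ[volume]
      fun ξ => (hw 1 ξ : ℂ) * (admissible_dual hs hs1).op F Y ξ := by
  filter_upwards [(admissible_dual hs hs1).coeFn_op F Y, ae_ne_zero] with ξ h₁ h₂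
  have := kernelFun_eq (hw (-1)) (jp (-s)) (fun _ => 1) F Y ξ
  simp only [mul_one, Complex.ofReal_one, one_mul] at this
  rw [h₁, this, ← mul_assoc, ← Complex.ofReal_mul, hw_mul_hw_neg 1 h₂]
  simp

theorem cv_energy_ae_eq (F G : L2C) :
    cv (fun η => (jp (-s) η : ℂ) * F η) (fun η => (hw (-1) η : ℂ) * G η) =ᵐ[volume]
      (admissible_energy hs hs1).op F G := by
  filter_upwards [(admissible_energy hs hs1).coeFn_op F G] with ξ h₁
  have := kernelFun_eq (fun _ => 1) (jp (-s)) (hw (-1)) F G ξ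
  simp only [one_mul, Complex.ofReal_one] at this
  rw [h₁, this]

theorem cv_square_ae_eq (F G : L2C) :
    cv (fun η => (jp (-s) η : ℂ) * F η) (fun η => (jp (-s) η : ℂ) * G η) =ᵐ[volume]
      (admissible_square hs).op F G := by
  filter_upwards [(admissible_square hs).coeFn_op F G] with ξ h₁
  have := kernelFun_eq (fun _ => 1) (jp (-s)) (jp (-s)) F G ξ
  simp only [one_mul, Complex.ofReal_one] at this
  rw [h₁, this]

/-- The product of `u ∈ H^s` and `v ∈ H^(s-1)` is in `Ḣ⁻¹`. -/
theorem IsProduct.hasWeight {u v p : TD} {F Φ : L2C} (hu : HasWeight (jp (-s)) u F)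
    (hv : HasWeight (jp (1 - s)) v Φ) (hp : IsProduct u v p) :
    HasWeight (hw 1) p ((admissible_prod hs hs1).op F Φ) := by
  obtain ⟨f, g, hf, hg, -, hc⟩ := hp
  refine HasFourierFunction.congr (f := cv f g) hc ?_
  rw [cv_congr_apply (hf.ae_eq hu) (hg.ae_eq hv)]
  exact cv_prod_ae_eq hs hs1 F Φ

theorem exists_isProduct (hs : 3 / 4 < s) (hs1 : s ≤ 1) {u v : TD} {F Φ : L2C}
    (hu : HasWeight (jp (-s)) u F)
    (hv : HasWeight (jp (1 - s)) v Φ) : ∃ p, IsProduct u v p := by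
  obtain ⟨p, hp⟩ := exists_hasWeight_hw_one ((admissible_prod hs hs1).op F Φ)
  refine ⟨p, _, _, hu, hv, ?_, HasFourierFunction.congr hp (cv_prod_ae_eq hs hs1 F Φ).symm⟩
  filter_upwards [(admissible_prod hs hs1).integrable F Φ, ae_ne_zero] with ξ h₁ h₂
  refine (h₁.const_mul (hw 1 ξ : ℂ)).congr (.of_forall fun η => ?_)
  have := hw_mul_hw_neg 1 h₂
  have e : hw 1 ξ * (hw (-1) ξ * jp (-s) η * jp (1 - s) (ξ - η)) =
      jp (-s) η * jp (1 - s) (ξ - η) := by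
    linear_combination jp (-s) η * jp (1 - s) (ξ - η) * this
  simp only
  rw [← mul_assoc, ← Complex.ofReal_mul, e]
  push_cast
  ring

end

/-! ### The nonlinear terms on the Fourier side -/

theorem coeFn_toC (f : L2R) : toC f =ᵐ[volume] fun x => (f x : ℂ) :=
  Complex.ofRealCLM.coeFn_compLp f

theorem toC_sub (f g : L2R) : toC (f - g) = toC f - toC g := by
  refine Lp.ext ?_
  filter_upwards [coeFn_toC (f - g), coeFn_toC f, coeFn_toC g, Lp.coeFn_sub (toC f) (toC g),
    Lp.coeFn_sub f g] with x h₁ h₂ h₃ h₄ h₅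
  rw [h₁, h₄, Pi.sub_apply, h₂, h₃, h₅, Pi.sub_apply, Complex.ofReal_sub]

theorem norm_toC (f : L2R) : ‖toC f‖ = ‖f‖ := by
  rw [Lp.norm_def, Lp.norm_def]
  congr 1
  refine eLpNorm_congr_norm_ae ?_
  filter_upwards [coeFn_toC f] with x h
  rw [h, Complex.norm_real]

theorem toC_injective : Function.Injective toC := by
  intro f g h
  have := norm_toC (f - g)
  rw [toC_sub, h, sub_self, norm_zero] at this
  exact sub_eq_zero.1 (norm_eq_zero.1 this.symm)

/-- The complex conjugate of an `L²` function. -/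
def conjL2 (φ : L2C) : L2C := (Lp.memLp φ).star.toLp

theorem coeFn_conjL2 (φ : L2C) : conjL2 φ =ᵐ[volume] fun x => (starRingEnd ℂ) (φ x) :=
  (Lp.memLp φ).star.coeFn_toLp

theorem coe_conjL2 (φ : L2C) : ((conjL2 φ : L2C) : TD) = conjTD φ :=
  IsFunction.ext (isFunction_Lp _) (isFunction_Lp φ).conj (coeFn_conjL2 φ)

theorem HasWeight.fourier_ae_eq {m : E3 → ℝ} {φ F : L2C} (hF : HasWeight m (φ : TD) F) :
    (𝓕 φ : L2C) =ᵐ[volume] fun ξ => (m ξ : ℂ) * F ξ :=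
  (hasFourierFunction_L2 φ).ae_eq hF

section
variable {s : ℝ} (hs : 3 / 4 < s) (hs1 : s ≤ 1)

theorem fourier_conjL2_ae_eq {s : ℝ} {φ F : L2C} (hF : HasWeight (jp (-s)) (φ : TD) F) :
    (𝓕 (conjL2 φ) : L2C) =ᵐ[volume] fun ξ => (jp (-s) ξ : ℂ) * conjRefl F ξ := by
  refine HasWeight.fourier_ae_eq ?_
  rw [coe_conjL2]
  exact hF.conj (jp_neg_arg _)

/-- For `φ ∈ H^s` the pointwise `|φ|²` is in `L²`, with Fourier transform the convolution. -/
theorem norm_sq_ae_eq {φ F : L2C} (hF : HasWeight (jp (-s)) (φ : TD) F) :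
    (fun x => ((‖φ x‖ ^ 2 : ℝ) : ℂ)) =ᵐ[volume]
      (𝓕⁻ ((admissible_square hs).op (conjRefl F) F) : L2C) := by
  have h := (isMultiplicand_L2 φ).ae_eq_fourierInv (conjL2 φ)
    ((admissible_square hs).op (conjRefl F) F) (by
      rw [cv_congr_apply (fourier_conjL2_ae_eq hF) hF.fourier_ae_eq]
      exact cv_square_ae_eq hs _ _)
  filter_upwards [h, coeFn_conjL2 φ] with x h₁ h₂
  rw [← h₁, h₂, ← Complex.normSq_eq_conj_mul_self, Complex.normSq_eq_norm_sq]

theorem cubic_ae_eq {φ F : L2C} (hF : HasWeight (jp (-s)) (φ : TD) F) (A : L2R) :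
    (fun x => ((A x * ‖φ x‖ ^ 2 : ℝ) : ℂ)) =ᵐ[volume]
      fun x => toC A x * (𝓕⁻ ((admissible_square hs).op (conjRefl F) F) : L2C) x := by
  filter_upwards [norm_sq_ae_eq hs hF, coeFn_toC A] with x h₁ h₂
  rw [← h₁, h₂, Complex.ofReal_mul]

theorem exists_cubic {s : ℝ} (hs : 3 / 4 < s) {φ F : L2C} (hF : HasWeight (jp (-s)) (φ : TD) F)
    (A : L2R) : ∃ W : TD, IsFunction W (fun x => ((A x * ‖φ x‖ ^ 2 : ℝ) : ℂ)) := by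
  refine exists_isFunction_of_memLp (p := 1) (memLp_one_iff_integrable.2 ?_)
  exact ((Lp.memLp (toC A)).integrable_mul (Lp.memLp _)).congr (cubic_ae_eq hs hF A).symm

/-- The term `A |φ|²` is in `Ḣ⁻¹`. -/
theorem hasWeight_cubic {φ F : L2C} (hF : HasWeight (jp (-s)) (φ : TD) F) {A : L2R} {A' : L2C}
    (hA : HasWeight (jp (-s)) (toC A : TD) A') {W : TD}
    (hW : IsFunction W (fun x => ((A x * ‖φ x‖ ^ 2 : ℝ) : ℂ))) :
    HasWeight (hw 1) W
      ((admissible_dual hs hs1).op A' ((admissible_square hs).op (conjRefl F) F)) := by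
  have hV := isMultiplicand_L2 (𝓕⁻ ((admissible_square hs).op (conjRefl F) F) : L2C)
  rw [FourierTransform.fourier_fourierInv_eq] at hV
  refine (hV.hasFourierFunction (toC A) (hW.congr (cubic_ae_eq hs hF A))).congr ?_
  rw [cv_congr_apply hA.fourier_ae_eq .rfl]
  exact cv_dual_ae_eq hs hs1 _ _

/-- For `φ ∈ H^s` and `A₀ ∈ Ḣ¹` the function `|φ|² A₀` is the product of the two `L²` functions
`conj φ` and `φ A₀`. -/
theorem quadratic_ae_eq {φ F : L2C} (hF : HasWeight (jp (-s)) (φ : TD) F) {A0 : TD} {G : L2C}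
    (hG : HasWeight (hw (-1)) A0 G) {a : E3 → ℂ} (ha : IsFunction A0 a) :
    (fun x => ((‖φ x‖ ^ 2 : ℝ) : ℂ) * a x) =ᵐ[volume]
      fun x => conjL2 φ x * (𝓕⁻ ((admissible_energy hs hs1).op F G) : L2C) x := by
  obtain ⟨a', ha'⟩ := hG.exists_isMultiplicand
  have h := ha'.ae_eq_fourierInv φ ((admissible_energy hs hs1).op F G) (by
    rw [cv_congr_apply hF.fourier_ae_eq .rfl]
    exact cv_energy_ae_eq hs hs1 _ _)
  filter_upwards [h, coeFn_conjL2 φ, ha.ae_eq ha'.fn] with x h₁ h₂ h₃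
  rw [← h₁, h₂, h₃, ← mul_assoc, ← Complex.normSq_eq_conj_mul_self, Complex.normSq_eq_norm_sq]

theorem exists_quadratic {s : ℝ} (hs : 3 / 4 < s) (hs1 : s ≤ 1) {φ F : L2C}
    (hF : HasWeight (jp (-s)) (φ : TD) F) {A0 : TD} {G : L2C}
    (hG : HasWeight (hw (-1)) A0 G) {a : E3 → ℂ} (ha : IsFunction A0 a) :
    ∃ V : TD, IsFunction V (fun x => ((‖φ x‖ ^ 2 : ℝ) : ℂ) * a x) := by
  refine exists_isFunction_of_memLp (p := 1) (memLp_one_iff_integrable.2 ?_)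
  exact ((Lp.memLp (conjL2 φ)).integrable_mul (Lp.memLp _)).congr
    (quadratic_ae_eq hs hs1 hF hG ha).symm

/-- The term `|φ|² A₀` is in `Ḣ⁻¹` for `A₀ ∈ Ḣ¹`. -/
theorem hasWeight_quadratic {φ F : L2C} (hF : HasWeight (jp (-s)) (φ : TD) F) {A0 : TD} {G : L2C}
    (hG : HasWeight (hw (-1)) A0 G) {a : E3 → ℂ} (ha : IsFunction A0 a) {V : TD}
    (hV : IsFunction V (fun x => ((‖φ x‖ ^ 2 : ℝ) : ℂ) * a x)) :
    HasWeight (hw 1) V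
      ((admissible_dual hs hs1).op (conjRefl F) ((admissible_energy hs hs1).op F G)) := by
  have hM := isMultiplicand_L2 (𝓕⁻ ((admissible_energy hs hs1).op F G) : L2C)
  rw [FourierTransform.fourier_fourierInv_eq] at hM
  refine (hM.hasFourierFunction (conjL2 φ)
    (hV.congr (quadratic_ae_eq hs hs1 hF hG ha))).congr ?_
  rw [cv_congr_apply (fourier_conjL2_ae_eq hF) .rfl]
  exact cv_dual_ae_eq hs hs1 _ _

/-! ### The elliptic equation -/

theorem HasWeight.neg_laplacian {A0 : TD} {G : L2C} (hG : HasWeight (hw (-1)) A0 G) :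
    HasWeight (hw 1) (-(Δ A0)) G := by
  refine (HasFourierFunction.laplacian hG).neg.congr ?_
  filter_upwards [ae_ne_zero] with ξ hξ
  have h := hw_mul_hw_neg 1 hξ
  rw [← hw_one]
  have : ((hw 1 ξ : ℝ) : ℂ) * ((hw (-1) ξ : ℝ) : ℂ) = 1 := by exact_mod_cast h
  linear_combination (hw 1 ξ : ℂ) * G ξ * this

theorem EllipticEq.ellOp_eq {φ F Φ : L2C} {φt A0 : TD} {G : L2C}
    (hF : HasWeight (jp (-s)) (φ : TD) F) (hΦ : HasWeight (jp (1 - s)) φt Φ)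
    (hG : HasWeight (hw (-1)) A0 G) (h : EllipticEq φ φt A0) :
    ellOp hs hs1 F G = imPart ((admissible_prod hs hs1).op F (conjRefl Φ)) := by
  obtain ⟨a, V, p, ha, hV, hp, heq⟩ := h
  have h₁ := hasWeight_quadratic hs hs1 hF hG ha (hV.congr (.of_forall fun x => by push_cast; rfl))
  have h₂ := (hp.hasWeight hs hs1 hF (hΦ.conj (jp_neg_arg _))).im (hw_neg_arg _)
  have h₃ := hG.neg_laplacian.add h₁
  rw [heq] at h₃
  exact h₃.unique (hw_ne_zero 1) h₂

theorem conjRefl_add (F G : L2C) : conjRefl (F + G) = conjRefl F + conjRefl G := by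
  have := conjRefl_sub (F + G) G
  rw [add_sub_cancel_right] at this
  exact (eq_sub_iff_add_eq.1 this).symm

theorem HasWeight.conjRefl_eq {m : E3 → ℝ} (hm : ∀ ξ, m (-ξ) = m ξ) (hm0 : ∀ᵐ ξ, m ξ ≠ 0)
    {u : TD} {F : L2C} (hF : HasWeight m u F) (hu : conjTD u = u) : conjRefl F = F := by
  have := hF.conj hm
  rw [hu] at this
  exact this.unique hm0 hF

theorem conjRefl_imPart (N : L2C) : conjRefl (imPart N) = imPart N := by
  obtain ⟨u, hu⟩ := exists_hasWeight_hw_one N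
  exact (hu.im (hw_neg_arg 1)).conjRefl_eq (hw_neg_arg 1) (hw_ne_zero 1) (conjTD_imTD u)

/-- The elliptic operator is real. -/
theorem conjRefl_ellOp {φ F : L2C} (hF : HasWeight (jp (-s)) (φ : TD) F) (G : L2C) :
    conjRefl (ellOp hs hs1 F G) = ellOp hs hs1 F (conjRefl G) := by
  obtain ⟨A0, a, hA0⟩ := exists_isMultiplicand_hw G
  have hG : HasWeight (hw (-1)) A0 G := hA0.ft
  obtain ⟨V, hV⟩ := exists_quadratic hs hs1 hF hG hA0.fn
  have h₁ := (hasWeight_quadratic hs hs1 hF hG hA0.fn hV).conj (hw_neg_arg 1)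
  have h₂ := hasWeight_quadratic hs hs1 hF (hG.conj (hw_neg_arg _)) hA0.fn.conj
    (hV.conj.congr (.of_forall fun x => by simp))
  rw [ellOp, ellOp, conjRefl_add, h₁.unique (hw_ne_zero 1) h₂]

/-- A solution on the Fourier side gives a solution `A₀` of the elliptic equation; it is real
because the elliptic operator is real and injective. -/
theorem ellipticEq_of_ellOp_eq {φ F Φ : L2C} {φt A0 : TD} {G : L2C}
    (hF : HasWeight (jp (-s)) (φ : TD) F) (hΦ : HasWeight (jp (1 - s)) φt Φ)
    (hG : HasWeight (hw (-1)) A0 G)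
    (h : ellOp hs hs1 F G = imPart ((admissible_prod hs hs1).op F (conjRefl Φ))) :
    EllipticEq φ φt A0 := by
  obtain ⟨a, ha⟩ := hG.exists_isMultiplicand
  have hreal : conjRefl G = G := by
    refine ellOp_injective hs hs1 F ?_
    rw [← conjRefl_ellOp hs hs1 hF, h, conjRefl_imPart]
  have hconj : conjTD A0 = A0 := by
    have := hG.conj (hw_neg_arg _)
    rw [hreal] at this
    exact this.inj hG
  have hare : (fun x => ((a x).re : ℂ)) =ᵐ[volume] a := by
    have := ha.fn.conj
    rw [hconj] at this
    filter_upwards [this.ae_eq ha.fn] with x hx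
    exact Complex.conj_eq_iff_re.1 hx
  have hfn := ha.fn.congr hare.symm
  obtain ⟨V, hV⟩ := exists_quadratic hs hs1 hF hG hfn
  obtain ⟨p, hp⟩ := exists_isProduct hs hs1 hF (hΦ.conj (jp_neg_arg _))
  refine ⟨fun x => (a x).re, V, p, hfn, hV.congr (.of_forall fun x => by push_cast; rfl), hp, ?_⟩
  have h₁ := hG.neg_laplacian.add (hasWeight_quadratic hs hs1 hF hG hfn hV)
  have h₂ := (hp.hasWeight hs hs1 hF (hΦ.conj (jp_neg_arg _))).im (hw_neg_arg _)
  rw [← h] at h₂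
  exact h₁.inj h₂

/-! ### The gradient equation -/

/-- The vector field `-Im (φ conj ∇φ) + A |φ|²`, whose gradient part determines `A_{0,t}`, as an
element of `Ḣ⁻¹` on the Fourier side. -/
def gradSource (F : L2C) (A : Fin 3 → L2C) (k : Fin 3) : L2C :=
  -imPart ((admissible_prod hs hs1).op F (conjRefl ((boundedSymbol_deriv k).mul F))) +
    (admissible_dual hs hs1).op (A k) ((admissible_square hs).op (conjRefl F) F)

/-- The symbol `-i ξ_k / |ξ|` of the Riesz transforms. -/
theorem boundedSymbol_riesz (k : Fin 3) :
    BoundedSymbol (fun ξ : E3 => -Complex.I * ((ξ k / ‖ξ‖ : ℝ) : ℂ)) 1 where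
  meas := by fun_prop
  bound ξ := by
    rw [norm_mul, norm_neg, Complex.norm_I, one_mul, Complex.norm_real, Real.norm_eq_abs, abs_div,
      abs_norm]
    exact div_le_one_of_le₀ (abs_apply_le_norm ξ k) (norm_nonneg ξ)

/-- The solution of `∇ b = (1 - P) N` on the Fourier side: `b = Δ⁻¹ ∇ · N`. -/
def gradPotential (N : Fin 3 → L2C) : L2C := ∑ k, (boundedSymbol_riesz k).mul (N k)

theorem coeFn_gradPotential (N : Fin 3 → L2C) :
    gradPotential N =ᵐ[volume]
      fun ξ => ∑ k, -Complex.I * ((ξ k / ‖ξ‖ : ℝ) : ℂ) * N k ξ := by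
  have h₁ : ∀ᵐ ξ : E3, ∀ k, (boundedSymbol_riesz k).mul (N k) ξ =
      -Complex.I * ((ξ k / ‖ξ‖ : ℝ) : ℂ) * N k ξ :=
    ae_all_iff.2 fun k => (boundedSymbol_riesz k).coeFn_mul (N k)
  filter_upwards [h₁, Lp.coeFn_fun_finsetSum Finset.univ
    fun k => (boundedSymbol_riesz k).mul (N k)] with ξ h₁ h₂
  rw [gradPotential, h₂]
  exact Finset.sum_congr rfl fun k _ => h₁ k

theorem norm_gradPotential_sub_le (N N' : Fin 3 → L2C) :
    ‖gradPotential N - gradPotential N'‖ ≤ ∑ k, ‖N k - N' k‖ := by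
  rw [gradPotential, gradPotential, ← Finset.sum_sub_distrib]
  refine (norm_sum_le _ _).trans (Finset.sum_le_sum fun k _ => ?_)
  rw [← BoundedSymbol.mul_sub]
  simpa using (boundedSymbol_riesz k).norm_mul_le (N k - N' k)

theorem norm_gradPotential_le (N : Fin 3 → L2C) : ‖gradPotential N‖ ≤ ∑ k, ‖N k‖ := by
  refine (norm_sum_le _ _).trans (Finset.sum_le_sum fun k _ => ?_)
  simpa using (boundedSymbol_riesz k).norm_mul_le (N k)

/-- The equation `∇ b = (1 - P) N` determines `b ∈ L²`: at a frequency `ξ ≠ 0` some component `ξ_j`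
can be divided out. -/
theorem IsGradientPart.fourier_eq {N : Fin 3 → TD} {n : Fin 3 → L2C} {b : L2C}
    (hN : ∀ k, HasWeight (hw 1) (N k) (n k))
    (h : IsGradientPart N fun j => ∂_{basisVec j} (b : TD)) : (𝓕 b : L2C) = gradPotential n := by
  obtain ⟨n', hn', hG⟩ := h
  have h₁ : ∀ᵐ ξ : E3, ∀ k, n' k ξ = (hw 1 ξ : ℂ) * n k ξ :=
    ae_all_iff.2 fun k => (hn' k).ae_eq (hN k)
  have h₂ : ∀ᵐ ξ : E3, ∀ j, 2 * Real.pi * Complex.I * (ξ j : ℂ) * (𝓕 b : L2C) ξ =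
      ∑ k, ((ξ j * ξ k / ‖ξ‖ ^ 2 : ℝ) : ℂ) * n' k ξ :=
    ae_all_iff.2 fun j => ((hasFourierFunction_L2 b).deriv j).ae_eq (hG j)
  refine Lp.ext ?_
  filter_upwards [h₁, h₂, ae_ne_zero, coeFn_gradPotential n] with ξ h₁ h₂ h₃ h₄
  obtain ⟨j, hj⟩ : ∃ j, ξ j ≠ 0 := by
    by_contra! hc
    exact h₃ (by ext j; simpa using hc j)
  have hξ : (‖ξ‖ : ℂ) ≠ 0 := by simpa using h₃
  have hj' : (ξ j : ℂ) ≠ 0 := by exact_mod_cast hj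
  have hπ : (Real.pi : ℂ) ≠ 0 := by exact_mod_cast Real.pi_ne_zero
  rw [h₄]
  have h₅ := h₂ j
  have e : ∑ k, ((ξ j * ξ k / ‖ξ‖ ^ 2 : ℝ) : ℂ) * n' k ξ =
      2 * Real.pi * Complex.I * (ξ j : ℂ) *
        ∑ k, -Complex.I * ((ξ k / ‖ξ‖ : ℝ) : ℂ) * n k ξ := by
    rw [Finset.mul_sum]
    refine Finset.sum_congr rfl fun k _ => ?_
    rw [h₁, hw_one]
    push_cast
    field_simp
    linear_combination ((ξ k : ℂ) * n k ξ) * Complex.I_sq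
  rw [e] at h₅
  exact mul_left_cancel₀ (by simp [hπ, hj', Complex.I_ne_zero]) h₅

theorem isGradientPart_of_fourier_eq {N : Fin 3 → TD} {n : Fin 3 → L2C} {b : L2C}
    (hN : ∀ k, HasWeight (hw 1) (N k) (n k)) (h : (𝓕 b : L2C) = gradPotential n) :
    IsGradientPart N fun j => ∂_{basisVec j} (b : TD) := by
  refine ⟨_, hN, fun j => ((hasFourierFunction_L2 b).deriv j).congr ?_⟩
  rw [h]
  filter_upwards [ae_ne_zero, coeFn_gradPotential n] with ξ h₃ h₄
  have hξ : (‖ξ‖ : ℂ) ≠ 0 := by simpa using h₃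
  rw [h₄, Finset.mul_sum]
  refine Finset.sum_congr rfl fun k _ => ?_
  rw [hw_one]
  push_cast
  field_simp
  linear_combination (-(ξ j : ℂ) * ξ k * n k ξ) * Complex.I_sq

theorem conjRefl_gradPotential {N : Fin 3 → L2C} (hN : ∀ k, conjRefl (N k) = N k) :
    conjRefl (gradPotential N) = gradPotential N := by
  have h₁ : ∀ᵐ ξ : E3, ∀ k, N k ξ = (starRingEnd ℂ) (N k (-ξ)) := by
    refine ae_all_iff.2 fun k => ?_
    filter_upwards [coeFn_conjRefl (N k)] with ξ h
    rw [← h, hN k]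
  refine Lp.ext ?_
  filter_upwards [coeFn_conjRefl (gradPotential N), ae_neg (coeFn_gradPotential N),
    coeFn_gradPotential N, h₁] with ξ h₂ h₃ h₄ h₅
  rw [h₂, h₃, h₄, map_sum]
  refine Finset.sum_congr rfl fun k _ => ?_
  rw [map_mul, ← h₅ k]
  simp [neg_div]

/-- The inverse Fourier transform of a function with the symmetry `Z = conj Z(-·)` is real. -/
theorem exists_toC_eq_fourierInv {Z : L2C} (hZ : conjRefl Z = Z) :
    ∃ b : L2R, (𝓕 (toC b) : L2C) = Z := by
  let c : L2C := 𝓕⁻ Z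
  have hc : HasFourierFunction (c : TD) Z := hasFourierFunction_fourierInv_L2 Z
  have hconj : conjTD c = c := by
    refine HasFourierFunction.ext hc.conj hc ?_
    filter_upwards [coeFn_conjRefl Z] with ξ h
    rw [← h, hZ]
  have hre := (isFunction_Lp c).conj
  rw [hconj] at hre
  refine ⟨Complex.reCLM.compLp c, ?_⟩
  have : toC (Complex.reCLM.compLp c) = c := by
    refine Lp.ext ?_
    filter_upwards [coeFn_toC (Complex.reCLM.compLp c), Complex.reCLM.coeFn_compLp c,
      hre.ae_eq (isFunction_Lp c)] with x h₁ h₂ h₃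
    rw [h₁, h₂]
    exact Complex.conj_eq_iff_re.1 h₃
  rw [this]
  exact FourierTransform.fourier_fourierInv_eq Z

theorem hasWeight_gradSource {φ F : L2C} (hF : HasWeight (jp (-s)) (φ : TD) F)
    {A : Fin 3 → L2R} {A' : Fin 3 → L2C} (hA : ∀ k, HasWeight (jp (-s)) (toC (A k) : TD) (A' k))
    {q W : Fin 3 → TD} (hq : ∀ k, IsProduct φ (conjTD (∂_{basisVec k} (φ : TD))) (q k))
    (hW : ∀ k, IsFunction (W k) (fun x => ((A k x * ‖φ x‖ ^ 2 : ℝ) : ℂ))) (k : Fin 3) :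
    HasWeight (hw 1) (-imTD (q k) + W k) (gradSource hs hs1 F A' k) :=
  (((hq k).hasWeight hs hs1 hF ((hF.deriv k).conj (jp_neg_arg _))).im (hw_neg_arg _)).neg.add
    (hasWeight_cubic hs hs1 hF (hA k) (hW k))

theorem GradientEq.fourier_eq {φ F : L2C} (hF : HasWeight (jp (-s)) (φ : TD) F)
    {A : Fin 3 → L2R} {A' : Fin 3 → L2C} (hA : ∀ k, HasWeight (jp (-s)) (toC (A k) : TD) (A' k))
    {A0t : L2R} (h : GradientEq φ A A0t) :
    (𝓕 (toC A0t) : L2C) = gradPotential (gradSource hs hs1 F A') := by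
  obtain ⟨q, W, hq, hW, hG⟩ := h
  exact hG.fourier_eq (hasWeight_gradSource hs hs1 hF hA hq hW)

theorem exists_gradientEq {s : ℝ} (hs : 3 / 4 < s) (hs1 : s ≤ 1) {φ F : L2C}
    (hF : HasWeight (jp (-s)) (φ : TD) F) {A : Fin 3 → L2R} {A' : Fin 3 → L2C}
    (hA : ∀ k, HasWeight (jp (-s)) (toC (A k) : TD) (A' k)) :
    ∃ A0t : L2R, GradientEq φ A A0t := by
  choose q hq using fun k =>
    exists_isProduct hs hs1 hF ((hF.deriv k).conj (jp_neg_arg _))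
  choose W hW using fun k => exists_cubic hs hF (A k)
  have hN := hasWeight_gradSource hs hs1 hF hA hq hW
  have hreal : ∀ k, conjRefl (gradSource hs hs1 F A' k) = gradSource hs hs1 F A' k := by
    refine fun k => (hN k).conjRefl_eq (hw_neg_arg 1) (hw_ne_zero 1) ?_
    have h₁ : conjTD (W k) = W k :=
      IsFunction.ext (hW k).conj (hW k) (.of_forall fun x => Complex.conj_ofReal _)
    have h₂ : conjTD (-imTD (q k)) = -imTD (q k) := by
      rw [← zero_sub, conjTD_sub, conjTD_imTD]
      congr 1
      ext h
      simp [conjTD_apply]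
    rw [conjTD_add, h₁, h₂]
  obtain ⟨b, hb⟩ := exists_toC_eq_fourierInv (conjRefl_gradPotential hreal)
  exact ⟨b, q, W, hq, hW, isGradientPart_of_fourier_eq hN hb⟩

end

/-! ### The data on the Fourier side -/

/-- The data `φ, A ∈ H^s`, `φ_t ∈ H^(s-1)` in terms of the `L²` functions `F = ⟨ξ⟩^s φ̂`,
`B_k = ⟨ξ⟩^s Â_k` and `Φ = ⟨ξ⟩^(s-1) φ̂_t`. -/
structure FourierData (s : ℝ) (φ : L2C) (A : Fin 3 → L2R) (φt : TD) (F : L2C) (B : Fin 3 → L2C)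
    (Φ : L2C) : Prop where
  phi : HasWeight (jp (-s)) (φ : TD) F
  vec : ∀ k, HasWeight (jp (-s)) (toC (A k) : TD) (B k)
  phit : HasWeight (jp (1 - s)) φt Φ

/-- The norm of the data in terms of their weighted Fourier transforms. -/
def dataSize (F : L2C) (B : Fin 3 → L2C) (Φ : L2C) : ℝ :=
  ‖F‖ + √(∑ k, ‖B k‖ ^ 2) + ‖Φ‖

section
variable {s : ℝ} {φ φ' : L2C} {A A' : Fin 3 → L2R} {φt φt' : TD} {F F' Φ Φ' : L2C}
  {B B' : Fin 3 → L2C}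

theorem IsData.exists_fourierData (h : IsData s φ A φt) :
    ∃ F B Φ, FourierData s φ A φt F B Φ := by
  obtain ⟨F, hF⟩ := exists_hasWeight_of_memSobolev h.phi
  choose B hB using fun k => exists_hasWeight_of_memSobolev (h.vec k)
  obtain ⟨Φ, hΦ⟩ := exists_hasWeight_of_memSobolev h.phit
  rw [neg_sub] at hΦ
  exact ⟨F, B, Φ, hF, hB, hΦ⟩

theorem FourierData.sub (h : FourierData s φ A φt F B Φ)
    (h' : FourierData s φ' A' φt' F' B' Φ') :
    FourierData s (φ - φ') (A - A') (φt - φt') (F - F') (B - B') (Φ - Φ') where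
  phi := by
    have : ((φ - φ' : L2C) : TD) = (φ : TD) - φ' :=
      map_sub (Lp.toTemperedDistributionCLM ℂ (volume : Measure E3) 2) φ φ'
    rw [this]
    exact h.phi.sub h'.phi
  vec k := by
    have : (toC ((A - A') k) : TD) = (toC (A k) : TD) - toC (A' k) := by
      rw [Pi.sub_apply, toC_sub]
      exact map_sub (Lp.toTemperedDistributionCLM ℂ (volume : Measure E3) 2) _ _
    rw [this]
    exact (h.vec k).sub (h'.vec k)
  phit := h.phit.sub h'.phit

theorem FourierData.dataNorm_eq (h : FourierData s φ A φt F B Φ) :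
    dataNorm s φ A φt = ENNReal.ofReal (dataSize F B Φ) := by
  have hΦ := h.phit
  rw [← neg_sub] at hΦ
  have hv : vecSobNorm s A = ENNReal.ofReal √(∑ k, ‖B k‖ ^ 2) := by
    rw [vecSobNorm, Real.sqrt_eq_rpow, ← ENNReal.ofReal_rpow_of_nonneg (by positivity)
      (by norm_num), ENNReal.ofReal_sum_of_nonneg fun k _ => by positivity]
    congr 1
    refine Finset.sum_congr rfl fun k _ => ?_
    rw [(h.vec k).sobNorm_eq, ENNReal.ofReal_pow (norm_nonneg _), ofReal_norm]
  rw [dataNorm, h.phi.sobNorm_eq, hv, hΦ.sobNorm_eq, dataSize,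
    ENNReal.ofReal_add (by positivity) (norm_nonneg _),
    ENNReal.ofReal_add (norm_nonneg _) (Real.sqrt_nonneg _), ofReal_norm, ofReal_norm]

theorem dataSize_nonneg (F : L2C) (B : Fin 3 → L2C) (Φ : L2C) : 0 ≤ dataSize F B Φ := by
  unfold dataSize; positivity

theorem norm_phi_le_dataSize (F : L2C) (B : Fin 3 → L2C) (Φ : L2C) : ‖F‖ ≤ dataSize F B Φ := by
  unfold dataSize
  linarith [norm_nonneg Φ, Real.sqrt_nonneg (∑ k, ‖B k‖ ^ 2)]

theorem norm_phit_le_dataSize (F : L2C) (B : Fin 3 → L2C) (Φ : L2C) :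
    ‖Φ‖ ≤ dataSize F B Φ := by
  unfold dataSize
  linarith [norm_nonneg F, Real.sqrt_nonneg (∑ k, ‖B k‖ ^ 2)]

theorem norm_vec_le_dataSize (F : L2C) (B : Fin 3 → L2C) (Φ : L2C) (k : Fin 3) :
    ‖B k‖ ≤ dataSize F B Φ := by
  have : ‖B k‖ ≤ √(∑ k, ‖B k‖ ^ 2) := by
    refine Real.le_sqrt_of_sq_le ?_
    exact Finset.single_le_sum (f := fun k => ‖B k‖ ^ 2) (fun k _ => by positivity)
      (Finset.mem_univ k)
  unfold dataSize
  linarith [norm_nonneg F, norm_nonneg Φ]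

/-! ### Estimates -/

variable (hs : 3 / 4 < s) (hs1 : s ≤ 1)

/-- The right-hand side `Im (φ conj φ_t)` of the elliptic equation as an element of `Ḣ⁻¹` on the
Fourier side. -/
def ellSource (F Φ : L2C) : L2C := imPart ((admissible_prod hs hs1).op F (conjRefl Φ))

theorem norm_ellSource_le (F Φ : L2C) :
    ‖ellSource hs hs1 F Φ‖ ≤ kernelBound (wt s) * ‖F‖ * ‖Φ‖ := by
  refine (norm_imPart_le _).trans ?_
  have := (admissible_prod hs hs1).norm_op_le F (conjRefl Φ)
  rwa [norm_conjRefl] at this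

theorem norm_ellSource_sub_le (F F' Φ Φ' : L2C) :
    ‖ellSource hs hs1 F Φ - ellSource hs hs1 F' Φ'‖ ≤
      kernelBound (wt s) * (‖F - F'‖ * ‖Φ‖ + ‖F'‖ * ‖Φ - Φ'‖) := by
  rw [ellSource, ellSource, ← imPart_sub]
  refine (norm_imPart_le _).trans ?_
  have := (admissible_prod hs hs1).norm_op_sub_le F F' (conjRefl Φ) (conjRefl Φ')
  rwa [← conjRefl_sub, norm_conjRefl, norm_conjRefl] at this

/-- The dependence of the elliptic operator on `φ`. -/
theorem norm_ellOp_sub_le (F F' G : L2C) :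
    ‖ellOp hs hs1 F G - ellOp hs hs1 F' G‖ ≤
      kernelBound (wt s) ^ 2 * ((‖F‖ + ‖F'‖) * ‖F - F'‖ * ‖G‖) := by
  have hc := one_le_kernelBound (wt s)
  set c := kernelBound (wt s)
  rw [ellOp, ellOp, add_sub_add_left_eq_sub]
  have h₁ := (admissible_dual hs hs1).norm_op_sub_le (conjRefl F) (conjRefl F')
    ((admissible_energy hs hs1).op F G) ((admissible_energy hs hs1).op F' G)
  rw [← conjRefl_sub, norm_conjRefl, norm_conjRefl] at h₁
  have h₂ := (admissible_energy hs hs1).norm_op_le F G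
  have h₃ := (admissible_energy hs hs1).norm_op_sub_le F F' G G
  rw [sub_self, norm_zero, mul_zero, add_zero] at h₃
  calc _ ≤ _ := h₁
    _ ≤ c * (‖F - F'‖ * (c * ‖F‖ * ‖G‖) + ‖F'‖ * (c * (‖F - F'‖ * ‖G‖))) := by gcongr
    _ = _ := by ring

theorem norm_gradSource_le (F : L2C) (B : Fin 3 → L2C) (k : Fin 3) :
    ‖gradSource hs hs1 F B k‖ ≤
      8 * kernelBound (wt s) * ‖F‖ ^ 2 + kernelBound (wt s) ^ 2 * (‖B k‖ * ‖F‖ ^ 2) := by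
  have hc := one_le_kernelBound (wt s)
  have hπ : 2 * Real.pi ≤ 8 := by linarith [Real.pi_le_four]
  have h₁ := norm_ellSource_le hs hs1 F ((boundedSymbol_deriv k).mul F)
  have h₂ := (boundedSymbol_deriv k).norm_mul_le F
  have h₃ := (admissible_dual hs hs1).norm_op_le (B k)
    ((admissible_square hs).op (conjRefl F) F)
  have h₄ := (admissible_square hs).norm_op_le (conjRefl F) F
  rw [norm_conjRefl] at h₄
  set c := kernelBound (wt s)
  rw [gradSource]
  refine (norm_add_le _ _).trans ?_
  rw [norm_neg]
  refine add_le_add (h₁.trans ?_) (h₃.trans ?_)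
  · calc _ ≤ c * ‖F‖ * (8 * ‖F‖) := by gcongr; exact h₂.trans (by gcongr)
      _ = _ := by ring
  · calc _ ≤ c * ‖B k‖ * (c * ‖F‖ * ‖F‖) := by gcongr
      _ = _ := by ring

theorem norm_gradSource_sub_le (F F' : L2C) (B B' : Fin 3 → L2C) (k : Fin 3) :
    ‖gradSource hs hs1 F B k - gradSource hs hs1 F' B' k‖ ≤
      8 * kernelBound (wt s) * ((‖F‖ + ‖F'‖) * ‖F - F'‖) +
        kernelBound (wt s) ^ 2 *
          (‖B k - B' k‖ * ‖F‖ ^ 2 + ‖B' k‖ * ((‖F‖ + ‖F'‖) * ‖F - F'‖)) := by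
  have hc := one_le_kernelBound (wt s)
  have hπ : 2 * Real.pi ≤ 8 := by linarith [Real.pi_le_four]
  have h₁ := norm_ellSource_sub_le hs hs1 F F' ((boundedSymbol_deriv k).mul F)
    ((boundedSymbol_deriv k).mul F')
  rw [← BoundedSymbol.mul_sub] at h₁
  have h₂ := (boundedSymbol_deriv k).norm_mul_le F
  have h₂' := (boundedSymbol_deriv k).norm_mul_le (F - F')
  have h₃ := (admissible_dual hs hs1).norm_op_sub_le (B k) (B' k)
    ((admissible_square hs).op (conjRefl F) F) ((admissible_square hs).op (conjRefl F') F')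
  have h₄ := (admissible_square hs).norm_op_le (conjRefl F) F
  have h₅ := (admissible_square hs).norm_op_sub_le (conjRefl F) (conjRefl F') F F'
  rw [norm_conjRefl] at h₄
  rw [← conjRefl_sub, norm_conjRefl, norm_conjRefl] at h₅
  set c := kernelBound (wt s)
  have e : gradSource hs hs1 F B k - gradSource hs hs1 F' B' k =
      -(ellSource hs hs1 F ((boundedSymbol_deriv k).mul F) -
        ellSource hs hs1 F' ((boundedSymbol_deriv k).mul F')) +
      ((admissible_dual hs hs1).op (B k) ((admissible_square hs).op (conjRefl F) F) -
        (admissible_dual hs hs1).op (B' k) ((admissible_square hs).op (conjRefl F') F')) := by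
    rw [gradSource, gradSource, ellSource, ellSource]
    abel
  rw [e]
  refine (norm_add_le _ _).trans ?_
  rw [norm_neg]
  refine add_le_add (h₁.trans ?_) (h₃.trans ?_)
  · calc _ ≤ c * (‖F - F'‖ * (8 * ‖F‖) + ‖F'‖ * (8 * ‖F - F'‖)) := by
          gcongr
          · exact h₂.trans (by gcongr)
          · exact h₂'.trans (by gcongr)
      _ = _ := by ring
  · calc _ ≤ c * (‖B k - B' k‖ * (c * ‖F‖ * ‖F‖) +
          ‖B' k‖ * (c * (‖F - F'‖ * ‖F‖ + ‖F'‖ * ‖F - F'‖))) := by gcongr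
      _ = _ := by ring

/-! ### Solutions -/

/-- On the Fourier side, the elliptic system becomes the invertible linear equation
`ellOp F G = ellSource F Φ` for `G = |∇| A₀` and an explicit formula for `A_{0,t}`. -/
theorem FourierData.exists_of_isSolution (h : FourierData s φ A φt F B Φ) {A0 : TD} {A0t : L2R}
    (hsol : IsSolution φ A φt A0 A0t) :
    ∃ G, HasWeight (hw (-1)) A0 G ∧ ellOp hs hs1 F G = ellSource hs hs1 F Φ ∧
      (𝓕 (toC A0t) : L2C) = gradPotential (gradSource hs hs1 F B) := by
  obtain ⟨G, hG⟩ := exists_hasWeight_of_homNorm_lt hsol.finite_norm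
  exact ⟨G, hG, hsol.elliptic.ellOp_eq hs hs1 h.phi h.phit hG,
    hsol.gradient.fourier_eq hs hs1 h.phi h.vec⟩

theorem FourierData.existsUnique {s : ℝ} {φ : L2C} {A : Fin 3 → L2R} {φt : TD} {F : L2C}
    {B : Fin 3 → L2C} {Φ : L2C} (hs : 3 / 4 < s) (hs1 : s ≤ 1) (h : FourierData s φ A φt F B Φ) :
    ∃! p : TD × L2R, IsSolution φ A φt p.1 p.2 := by
  obtain ⟨G, hG⟩ := ellOp_surjective hs hs1 F (ellSource hs hs1 F Φ)
  obtain ⟨A0, a, hA0⟩ := exists_isMultiplicand_hw G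
  have hA0' : HasWeight (hw (-1)) A0 G := hA0.ft
  obtain ⟨A0t, hA0t⟩ := exists_gradientEq hs hs1 h.phi h.vec
  have hsol : IsSolution φ A φt A0 A0t :=
    ⟨by rw [hA0'.homNorm_eq]; exact enorm_lt_top,
      ellipticEq_of_ellOp_eq hs hs1 h.phi h.phit hA0' hG, hA0t⟩
  refine ⟨(A0, A0t), hsol, fun p hp => ?_⟩
  obtain ⟨G₁, h₁, h₂, h₃⟩ := h.exists_of_isSolution hs hs1 hp
  obtain ⟨G₂, h₄, h₅, h₆⟩ := h.exists_of_isSolution hs hs1 hsol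
  have hGG : G₁ = G₂ := ellOp_injective hs hs1 F (h₂.trans h₅.symm)
  refine Prod.ext ((hGG ▸ h₁).inj h₄) (toC_injective ?_)
  have := congrArg (fun b : L2C => (𝓕⁻ b : L2C)) (h₃.trans h₆.symm)
  simpa using this

theorem norm_eq_of_fourier_eq {b : L2R} {Z : L2C} (h : (𝓕 (toC b) : L2C) = Z) :
    ‖b‖ = ‖Z‖ := by
  rw [← h, Lp.norm_fourier_eq, norm_toC]

theorem norm_potential_le {G : L2C} (hG : ellOp hs hs1 F G = ellSource hs hs1 F Φ) :
    ‖G‖ ≤ kernelBound (wt s) * dataSize F B Φ ^ 2 := by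
  have hc := one_le_kernelBound (wt s)
  have h := norm_le_norm_ellOp hs hs1 F G
  rw [hG] at h
  refine h.trans ((norm_ellSource_le hs hs1 F Φ).trans ?_)
  rw [sq, mul_assoc]
  have := norm_phi_le_dataSize F B Φ
  have := norm_phit_le_dataSize F B Φ
  have := dataSize_nonneg F B Φ
  gcongr

theorem norm_gradPotential_gradSource_le (F Φ : L2C) (B : Fin 3 → L2C) :
    ‖gradPotential (gradSource hs hs1 F B)‖ ≤
      60 * kernelBound (wt s) ^ 3 * (dataSize F B Φ ^ 2 + dataSize F B Φ ^ 3) := by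
  have hc := one_le_kernelBound (wt s)
  have hF := norm_phi_le_dataSize F B Φ
  have hB := norm_vec_le_dataSize F B Φ
  have hD := dataSize_nonneg F B Φ
  set c := kernelBound (wt s)
  set D := dataSize F B Φ
  have hc₁ : c ≤ c ^ 3 := le_self_pow₀ hc (by norm_num)
  have hc₂ : c ^ 2 ≤ c ^ 3 := pow_le_pow_right₀ hc (by norm_num)
  calc _ ≤ ∑ k, ‖gradSource hs hs1 F B k‖ := norm_gradPotential_le _
    _ ≤ ∑ _k : Fin 3, (8 * c ^ 3 * D ^ 2 + c ^ 3 * (D * D ^ 2)) := by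
        refine Finset.sum_le_sum fun k _ => (norm_gradSource_le hs hs1 F B k).trans ?_
        have := hB k
        gcongr
    _ = 24 * (c ^ 3 * D ^ 2) + 3 * (c ^ 3 * D ^ 3) := by
        simp only [Finset.sum_const, Finset.card_univ, Fintype.card_fin, nsmul_eq_mul]
        ring
    _ ≤ _ := by
        have : 0 ≤ c ^ 3 * D ^ 2 := by positivity
        have : 0 ≤ c ^ 3 * D ^ 3 := by positivity
        linarith

/-- The difference `G - G'` solves the elliptic equation for `φ` with source
`(N - N') - (|φ|² - |φ'|²) A₀'`, where `N` and `N'` are the two right-hand sides. -/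
theorem norm_potential_sub_le {G G' : L2C} (hG : ellOp hs hs1 F G = ellSource hs hs1 F Φ)
    (hG' : ellOp hs hs1 F' G' = ellSource hs hs1 F' Φ') :
    ‖G - G'‖ ≤ 60 * kernelBound (wt s) ^ 3 * (1 + dataSize F B Φ + dataSize F' B' Φ') ^ 5 *
      dataSize (F - F') (B - B') (Φ - Φ') := by
  have hc := one_le_kernelBound (wt s)
  have hbound := norm_potential_le (B := B') hs hs1 hG'
  have hF := norm_phi_le_dataSize F B Φ
  have hF' := norm_phi_le_dataSize F' B' Φ'
  have hΦ := norm_phit_le_dataSize F B Φ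
  have hdF := norm_phi_le_dataSize (F - F') (B - B') (Φ - Φ')
  have hdΦ := norm_phit_le_dataSize (F - F') (B - B') (Φ - Φ')
  have hD := dataSize_nonneg F B Φ
  have hD' := dataSize_nonneg F' B' Φ'
  have hd := dataSize_nonneg (F - F') (B - B') (Φ - Φ')
  have e : ellOp hs hs1 F (G - G') = ellSource hs hs1 F Φ - ellSource hs hs1 F' Φ' -
      (ellOp hs hs1 F G' - ellOp hs hs1 F' G') := by
    rw [ellOp_sub, hG, hG']
    abel
  have h := norm_le_norm_ellOp hs hs1 F (G - G')
  rw [e] at h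
  have h₁ := norm_ellSource_sub_le hs hs1 F F' Φ Φ'
  have h₂ := norm_ellOp_sub_le hs hs1 F F' G'
  set c := kernelBound (wt s)
  set D := dataSize F B Φ
  set D' := dataSize F' B' Φ'
  set d := dataSize (F - F') (B - B') (Φ - Φ')
  set M := 1 + D + D' with hM
  have hM1 : 1 ≤ M := by linarith
  have hc₁ : c ≤ c ^ 3 := le_self_pow₀ hc (by norm_num)
  have hMp : M ≤ M ^ 5 := le_self_pow₀ hM1 (by norm_num)
  have hMp₃ : M ^ 3 ≤ M ^ 5 := pow_le_pow_right₀ hM1 (by norm_num)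
  have hFM : ‖F‖ + ‖F'‖ ≤ M := by linarith
  have hDM : D' ≤ M := by linarith
  calc ‖G - G'‖ ≤ c * (‖F - F'‖ * ‖Φ‖ + ‖F'‖ * ‖Φ - Φ'‖) +
        c ^ 2 * ((‖F‖ + ‖F'‖) * ‖F - F'‖ * ‖G'‖) :=
        h.trans ((norm_sub_le _ _).trans (add_le_add h₁ h₂))
    _ ≤ c * (d * M + M * d) + c ^ 2 * (M * d * (c * M ^ 2)) := by
        gcongr
        · linarith
        · linarith
        · exact hbound.trans (by gcongr)
    _ = 2 * (c * M * d) + c ^ 3 * M ^ 3 * d := by ring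
    _ ≤ 2 * (c ^ 3 * M ^ 5 * d) + c ^ 3 * M ^ 5 * d := by gcongr
    _ ≤ _ := by
        have : 0 ≤ c ^ 3 * M ^ 5 * d := by positivity
        linarith

theorem norm_gradPotential_gradSource_sub_le (F F' Φ Φ' : L2C) (B B' : Fin 3 → L2C) :
    ‖gradPotential (gradSource hs hs1 F B) - gradPotential (gradSource hs hs1 F' B')‖ ≤
      60 * kernelBound (wt s) ^ 3 * (1 + dataSize F B Φ + dataSize F' B' Φ') ^ 5 *
        dataSize (F - F') (B - B') (Φ - Φ') := by
  have hc := one_le_kernelBound (wt s)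
  have hF := norm_phi_le_dataSize F B Φ
  have hF' := norm_phi_le_dataSize F' B' Φ'
  have hB' := norm_vec_le_dataSize F' B' Φ'
  have hdF := norm_phi_le_dataSize (F - F') (B - B') (Φ - Φ')
  have hdB := norm_vec_le_dataSize (F - F') (B - B') (Φ - Φ')
  have hD := dataSize_nonneg F B Φ
  have hD' := dataSize_nonneg F' B' Φ'
  have hd := dataSize_nonneg (F - F') (B - B') (Φ - Φ')
  set c := kernelBound (wt s)
  set D := dataSize F B Φ
  set D' := dataSize F' B' Φ'
  set d := dataSize (F - F') (B - B') (Φ - Φ')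
  set M := 1 + D + D' with hM
  have hM1 : 1 ≤ M := by linarith
  have hc₁ : c ≤ c ^ 3 := le_self_pow₀ hc (by norm_num)
  have hc₂ : c ^ 2 ≤ c ^ 3 := pow_le_pow_right₀ hc (by norm_num)
  have hMp : M ≤ M ^ 5 := le_self_pow₀ hM1 (by norm_num)
  have hMp₂ : M ^ 2 ≤ M ^ 5 := pow_le_pow_right₀ hM1 (by norm_num)
  have hFM : ‖F‖ + ‖F'‖ ≤ M := by linarith
  have hFM' : ‖F‖ ≤ M := by linarith
  calc _ ≤ ∑ k, ‖gradSource hs hs1 F B k - gradSource hs hs1 F' B' k‖ :=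
        norm_gradPotential_sub_le _ _
    _ ≤ ∑ _k : Fin 3, (8 * c * (M * d) + c ^ 2 * (d * M ^ 2 + M * (M * d))) := by
        refine Finset.sum_le_sum fun k _ => (norm_gradSource_sub_le hs hs1 F F' B B' k).trans ?_
        have h₁ : ‖B k - B' k‖ ≤ d := hdB k
        have h₂ : ‖B' k‖ ≤ M := (hB' k).trans (by linarith)
        gcongr
    _ = 24 * (c * M * d) + 6 * (c ^ 2 * M ^ 2 * d) := by
        simp only [Finset.sum_const, Finset.card_univ, Fintype.card_fin, nsmul_eq_mul]
        ring
    _ ≤ 24 * (c ^ 3 * M ^ 5 * d) + 6 * (c ^ 3 * M ^ 5 * d) := by gcongr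
    _ ≤ _ := by
        have : 0 ≤ c ^ 3 * M ^ 5 * d := by positivity
        linarith

end

/-! ### Passage to extended norms -/

theorem ofReal_sum_Icc {D : ℝ} (hD : 0 ≤ D) :
    ∑ j ∈ Finset.Icc 2 3, ENNReal.ofReal D ^ j = ENNReal.ofReal (D ^ 2 + D ^ 3) := by
  rw [ENNReal.ofReal_add (by positivity) (by positivity), ENNReal.ofReal_pow hD,
    ENNReal.ofReal_pow hD, show Finset.Icc 2 3 = {2, 3} from rfl, Finset.sum_pair (by norm_num)]

/-- Transfers a real Lipschitz bound to the extended norms of the statement. -/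
theorem enorm_le_ofReal_mul_pow_mul {x : L2C} {C D D' d : ℝ} (hC : 0 ≤ C) (hD : 0 ≤ D)
    (hD' : 0 ≤ D') (h : ‖x‖ ≤ C * (1 + D + D') ^ 5 * d) :
    ‖x‖ₑ ≤ ENNReal.ofReal C * (1 + ENNReal.ofReal D + ENNReal.ofReal D') ^ 5 *
      ENNReal.ofReal d := by
  rw [← ofReal_norm]
  refine (ENNReal.ofReal_le_ofReal h).trans_eq ?_
  rw [ENNReal.ofReal_mul (by positivity), ENNReal.ofReal_mul hC,
    ENNReal.ofReal_pow (by positivity), ENNReal.ofReal_add (by positivity) hD',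
    ENNReal.ofReal_add zero_le_one hD, ENNReal.ofReal_one]

end MKG

end

theorem proposition3p1 (s : ℝ) (hs : 3 / 4 < s) (hs1 : s ≤ 1) :
    ∃ C : ℝ≥0,
      (∀ (φ : MKG.L2C) (A : Fin 3 → MKG.L2R) (φt : MKG.TD), MKG.IsData s φ A φt →
        (∃! p : MKG.TD × MKG.L2R, MKG.IsSolution φ A φt p.1 p.2) ∧
        ∀ (A0 : MKG.TD) (A0t : MKG.L2R), MKG.IsSolution φ A φt A0 A0t →
          (∀ p : MKG.TD, MKG.IsProduct φ (MKG.conjTD φt) p →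
            MKG.homNorm (-1) p < ∞ ∧ MKG.homNorm 1 A0 ≤ C * MKG.homNorm (-1) p) ∧
          MKG.homNorm 1 A0 ≤ C * ∑ j ∈ Finset.Icc 2 3, MKG.dataNorm s φ A φt ^ j ∧
          ‖A0t‖ₑ ≤ C * ∑ j ∈ Finset.Icc 2 3, MKG.dataNorm s φ A φt ^ j) ∧
      ∀ (φ φ' : MKG.L2C) (A A' : Fin 3 → MKG.L2R) (φt φt' : MKG.TD),
        MKG.IsData s φ A φt → MKG.IsData s φ' A' φt' →
        ∀ (A0 A0' : MKG.TD) (A0t A0t' : MKG.L2R),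
          MKG.IsSolution φ A φt A0 A0t → MKG.IsSolution φ' A' φt' A0' A0t' →
          MKG.homNorm 1 (A0 - A0') ≤
            C * (1 + MKG.dataNorm s φ A φt + MKG.dataNorm s φ' A' φt') ^ 5 *
              MKG.dataNorm s (φ - φ') (A - A') (φt - φt') ∧
          ‖A0t - A0t'‖ₑ ≤
            C * (1 + MKG.dataNorm s φ A φt + MKG.dataNorm s φ' A' φt') ^ 5 *
              MKG.dataNorm s (φ - φ') (A - A') (φt - φt') := by
  have hc := MKG.one_le_kernelBound (MKG.wt s)
  have hc₃ : MKG.kernelBound (MKG.wt s) ≤ MKG.kernelBound (MKG.wt s) ^ 3 :=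
    le_self_pow₀ hc (by norm_num)
  have hK : (0 : ℝ) ≤ 60 * MKG.kernelBound (MKG.wt s) ^ 3 := by positivity
  -- `60` leaves room for the `2π ≤ 8` of each derivative and the sum over three components
  refine ⟨(60 * MKG.kernelBound (MKG.wt s) ^ 3).toNNReal, ?_, ?_⟩
  · intro φ A φt hdata
    obtain ⟨F, B, Φ, h⟩ := hdata.exists_fourierData
    refine ⟨h.existsUnique hs hs1, fun A0 A0t hsol => ?_⟩
    obtain ⟨G, hG, hell, hgrad⟩ := h.exists_of_isSolution hs hs1 hsol
    have hD := MKG.dataSize_nonneg F B Φ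
    rw [hG.homNorm_eq, h.dataNorm_eq, MKG.ofReal_sum_Icc hD]
    refine ⟨fun p hp => ?_, ?_, ?_⟩
    · have hprod := hp.hasWeight hs hs1 h.phi (h.phit.conj (MKG.jp_neg_arg _))
      have hnorm : MKG.homNorm (-1) p =
          ‖(MKG.admissible_prod hs hs1).op F (MKG.conjRefl Φ)‖ₑ :=
        MKG.HasWeight.homNorm_eq (by rw [neg_neg]; exact hprod)
      rw [hnorm]
      refine ⟨enorm_lt_top, ?_⟩
      have hle := (MKG.norm_le_norm_ellOp hs hs1 F G).trans
        ((congrArg norm hell).trans_le (MKG.norm_imPart_le _))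
      rw [← ofReal_norm, ← ofReal_norm]
      refine (ENNReal.ofReal_le_ofReal hle).trans (le_mul_of_one_le_left' ?_)
      exact ENNReal.one_le_ofReal.2 (by linarith)
    · rw [← ofReal_norm]
      refine (ENNReal.ofReal_le_ofReal ?_).trans_eq (ENNReal.ofReal_mul hK)
      refine (MKG.norm_potential_le (B := B) hs hs1 hell).trans ?_
      have : (0 : ℝ) ≤ MKG.dataSize F B Φ ^ 3 := by positivity
      gcongr <;> linarith
    · rw [← ofReal_norm]
      refine (ENNReal.ofReal_le_ofReal ?_).trans_eq (ENNReal.ofReal_mul hK)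
      rw [MKG.norm_eq_of_fourier_eq hgrad]
      exact MKG.norm_gradPotential_gradSource_le hs hs1 F Φ B
  · intro φ φ' A A' φt φt' hdata hdata' A0 A0' A0t A0t' hsol hsol'
    obtain ⟨F, B, Φ, h⟩ := hdata.exists_fourierData
    obtain ⟨F', B', Φ', h'⟩ := hdata'.exists_fourierData
    obtain ⟨G, hG, hell, hgrad⟩ := h.exists_of_isSolution hs hs1 hsol
    obtain ⟨G', hG', hell', hgrad'⟩ := h'.exists_of_isSolution hs hs1 hsol'
    have hD := MKG.dataSize_nonneg F B Φ
    have hD' := MKG.dataSize_nonneg F' B' Φ'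
    rw [(hG.sub hG').homNorm_eq, h.dataNorm_eq, h'.dataNorm_eq, (h.sub h').dataNorm_eq]
    refine ⟨MKG.enorm_le_ofReal_mul_pow_mul hK hD hD'
      (MKG.norm_potential_sub_le hs hs1 hell hell'), ?_⟩
    have hdiff : 𝓕 (MKG.toC (A0t - A0t')) =
        MKG.gradPotential (MKG.gradSource hs hs1 F B) -
          MKG.gradPotential (MKG.gradSource hs hs1 F' B') := by
      rw [MKG.toC_sub, ← hgrad, ← hgrad']
      exact map_sub (Lp.fourierTransformₗᵢ MKG.E3 ℂ) _ _
    have hnorm := MKG.norm_eq_of_fourier_eq hdiff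
    rw [← ofReal_norm, hnorm, ofReal_norm]
    exact MKG.enorm_le_ofReal_mul_pow_mul hK hD hD'
      (MKG.norm_gradPotential_gradSource_sub_le hs hs1 F F' Φ Φ' B B')
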